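/- **Setting.** Fix an order $M\ge 2$, prior probabilities $\pi_1,\pi_2>0$ with $\pi_1+\pi_2=1$, and constants $C_0\ge 1$ and $\kappa\in\mathbb R$. For dimensions $d=(d_1,\dots,d_M)$, a parameter $\theta=(\mathcal M_1,\mathcal M_2,\boldsymbol\Sigma)$ consists of two tensors $\mathcal M_1,\mathcal M_2\in\mathbb R^{d_1\times\cdots\times d_M}$ and positive definite matrices $\boldsymbol\Sigma=[\Sigma_m]_{m=1}^M$, $\Sigma_m\in\mathbb R^{d_m\times d_m}$. Class $k\in\{1,2\}$ has prior probability $\pi_k$, and an observation of class $k$ has the tensor normal law $\mathcal{TN}(\mathcal M_k;\boldsymbol\Sigma)$, i.e. the law of $\mathcal M_k+\mathcal Z\times_{m=1}^M\Sigma_m^{1/2}$ with $\mathcal Z$ having i.i.d. $N(0,1)$ entries. Put $\mathcal D=\mathcal M_2-\mathcal M_1$, $\mathcal B=\mathcal D\times_{m=1}^M\Sigma_m^{-1}$ (the discriminant tensor) and $\Delta(\theta)=\sqrt{\langle\mathcal B,\mathcal D\rangle}$ (the signal-to-noise ratio). Let $\mathcal H=\mathcal H(d,R,C_0)$ be the set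 of all $\theta$ such that $$C_0^{-1}\le\lambda_{\min}(\otimes_{m=1}^M\Sigma_m)\le\lambda_{\max}(\otimes_{m=1}^M\Sigma_m)\le C_0,\qquad \mathcal B=\sum_{r=1}^R w_r\,a_{r1}\circ\cdots\circ a_{rM}\ \text{ with } w_r>0,\ \|a_{rm}\|_2=1,$$ and let $\mathcal H_\Delta=\{\theta\in\mathcal H:\Delta(\theta)=\Delta\}$. The training data are independent and consist of $n_1\ge1$ observations of class 1 and $n_2\ge1$ observations of class 2, where $n_1\le\kappa n_2$ and $n_2\le\kappa n_1$; put $n=\min(n_1,n_2)$. A classifier $\hat\Upsilon$ is any measurable function of the training data and of the observation to be classified. Given the training data, $\mathcal R_\theta(\hat\Upsilon)$ is its probability of misclassifying a new observation from $\pi_1\mathcal{TN}(\mathcal M_1;\boldsymbol\Sigma)+\pi_2\mathcal{TN}(\mathcal M_2;\boldsymbol\Sigma)$, and $\mathcal R_{\rm opt}(\theta)$ is the smallest (Bayes) misclassification probability of a rule that may depend on $\theta$. Below, $\mathbb P_\theta$ is the law of the training data, and always $1\le R\le\min_m d_m$. **Theorem.** (i) For all constants $0<c_1<c_2$, $K$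 and $\gamma>0$ there is a constant $C_\gamma>0$, depending only on these and on $M,\pi_1,\pi_2,C_0,\kappa$, such that for all $d,R,n_1,n_2$ with $\frac{\sum_{m=1}^M d_mR}{n}\le K$ and all $\Delta$ with $c_1<\Delta\le c_2$, $$\inf_{\hat\Upsilon}\ \sup_{\theta\in\mathcal H_\Delta}\ \mathbb P_\theta\left(\mathcal R_\theta(\hat\Upsilon)-\mathcal R_{\rm opt}(\theta)\ge C_\gamma\,\frac{\sum_{m=1}^M d_mR}{n}\right)\ge 1-\gamma .$$ (ii) For every $\gamma>0$ there is a constant $C_\gamma>0$, depending only on $\gamma,M,\pi_1,\pi_2,C_0,\kappa$, such that for all sequences $d=d^{(n)}$, $R=R_n$, $(n_1,n_2)=(n_1(n),n_2(n))$ with $\min(n_1,n_2)=n$, and $\Delta=\Delta_n$ with $\Delta_n\to\infty$ and $\sqrt{\sum_{m=1}^M d_mR/n}=o(\Delta_n)$ as $n\to\infty$, there is a sequence $\vartheta_n=o(1)$ such that for all sufficiently large $n$, $$\inf_{\hat\Upsilon}\ \sup_{\theta\in\mathcal H_{\Delta_n}}\ \mathbb P_\theta\left(\mathcal R_\theta(\hat\Upsilon)-\mathcal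 R_{\rm opt}(\theta)\ge C_\gamma\exp\left\{-\left(\tfrac18+\vartheta_n\right)\Delta_n^2\right\}\frac{\sum_{m=1}^M d_mR}{n}\right)\ge 1-\gamma .$$ -/

import Mathlib

open MeasureTheory ProbabilityTheory Filter Topology Asymptotics
open scoped ENNReal

noncomputable section

namespace TGMM

/-- Real tensors of order `M` and size `d 0 × ⋯ × d (M - 1)`, indexed by multi-indices. -/
abbrev Tensor {M : ℕ} (d : Fin M → ℕ) : Type := (∀ m, Fin (d m)) → ℝ

/-- A family of square matrices, one for each mode. -/
abbrev ModeMatrices {M : ℕ} (d : Fin M → ℕ) : Type := ∀ m, Matrix (Fin (d m)) (Fin (d m)) ℝ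

section Algebra

variable {M : ℕ} {d : Fin M → ℕ}

/-- The inner product `⟨X, Y⟩ = ∑_I X_I Y_I`. -/
def inner (X Y : Tensor d) : ℝ := ∑ I, X I * Y I

/-- The Kronecker product of the mode matrices, as a matrix indexed by multi-indices. -/
def kron (A : ModeMatrices d) : Matrix (∀ m, Fin (d m)) (∀ m, Fin (d m)) ℝ :=
  Matrix.of fun I J => ∏ m, A m (I m) (J m)

/-- The product `X ×_{m=1}^M A_m` of a tensor with a matrix along every mode. -/
def modeProd (X : Tensor d) (A : ModeMatrices d) : Tensor d :=
  fun I => ∑ J, X J * ∏ m, A m (I m) (J m)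

/-- `B = ∑_{r=1}^R w_r a_{r1} ∘ ⋯ ∘ a_{rM}` with weights `w_r > 0` and unit vectors `a_{rm}`. -/
def HasCPDecomposition (R : ℕ) (B : Tensor d) : Prop :=
  ∃ (w : Fin R → ℝ) (a : Fin R → ∀ m, Fin (d m) → ℝ),
    (∀ r, 0 < w r) ∧ (∀ r m, ∑ i, a r m i ^ 2 = 1) ∧
      ∀ I, B I = ∑ r, w r * ∏ m, a r m (I m)

end Algebra

open scoped MatrixOrder in
/-- The tensor normal distribution `TN(μ; Σ)`: the law of `μ + Z ×_{m=1}^M Σ_m^{1/2}`, where `Z` has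
independent standard normal entries and `Σ_m^{1/2}` is the positive semidefinite square root. -/
def tensorNormal {M : ℕ} {d : Fin M → ℕ} (μ : Tensor d) (S : ModeMatrices d) :
    Measure (Tensor d) :=
  (Measure.pi fun _ : (∀ m, Fin (d m)) => gaussianReal 0 1).map
    fun Z => μ + modeProd Z fun m => CFC.sqrt (S m)

/-- The parameter `θ = (M₁, M₂, Σ)` of a two-class tensor Gaussian mixture with common
mode covariance matrices. -/
structure Param {M : ℕ} (d : Fin M → ℕ) where
  mean₁ : Tensor d
  mean₂ : Tensor d
  cov : ModeMatrices d

section Model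

variable {M : ℕ} {d : Fin M → ℕ}

/-- `D = M₂ - M₁`. -/
def Param.diff (θ : Param d) : Tensor d := θ.mean₂ - θ.mean₁

/-- The discriminant tensor `B = D ×_{m=1}^M Σ_m⁻¹`. -/
def Param.discriminant (θ : Param d) : Tensor d := modeProd θ.diff fun m => (θ.cov m)⁻¹

/-- The signal-to-noise ratio `Δ = √⟨B, D⟩`. -/
def Param.snr (θ : Param d) : ℝ := √(inner θ.discriminant θ.diff)

/-- The misclassification error of a rule `Υ` for a new observation from
`p₁ TN(M₁; Σ) + p₂ TN(M₂; Σ)`; `false` stands for class 1 and `true` for class 2. -/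
def risk (p₁ p₂ : ℝ) (θ : Param d) (Υ : Tensor d → Bool) : ℝ :=
  p₁ * (tensorNormal θ.mean₁ θ.cov).real {x | Υ x = true} +
    p₂ * (tensorNormal θ.mean₂ θ.cov).real {x | Υ x = false}

/-- The optimal (Bayes) misclassification error, over all measurable rules. -/
def optRisk (p₁ p₂ : ℝ) (θ : Param d) : ℝ :=
  ⨅ Υ : {Υ : Tensor d → Bool // Measurable Υ}, risk p₁ p₂ θ Υ.1

/-- The excess misclassification risk. -/
def excessRisk (p₁ p₂ : ℝ) (θ : Param d) (Υ : Tensor d → Bool) : ℝ :=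
  risk p₁ p₂ θ Υ - optRisk p₁ p₂ θ

/-- The parameter space `H`: the covariance matrices are positive definite, all eigenvalues of their
Kronecker product lie in `[C₀⁻¹, C₀]`, and the discriminant tensor has a CP decomposition with
`R` terms. -/
def paramSpace (d : Fin M → ℕ) (R : ℕ) (C₀ : ℝ) : Set (Param d) :=
  {θ | (∀ m, (θ.cov m).PosDef) ∧ (∀ l ∈ spectrum ℝ (kron θ.cov), C₀⁻¹ ≤ l ∧ l ≤ C₀) ∧
    HasCPDecomposition R θ.discriminant}

/-- The training data: `n₁` observations from class 1 and `n₂` observations from class 2. -/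
abbrev Sample (d : Fin M → ℕ) (n₁ n₂ : ℕ) : Type :=
  (Fin n₁ → Tensor d) × (Fin n₂ → Tensor d)

/-- The law of the training data: all observations are independent. -/
def sampleLaw (θ : Param d) (n₁ n₂ : ℕ) : Measure (Sample d n₁ n₂) :=
  (Measure.pi fun _ : Fin n₁ => tensorNormal θ.mean₁ θ.cov).prod
    (Measure.pi fun _ : Fin n₂ => tensorNormal θ.mean₂ θ.cov)

/-- Data-driven classifiers: jointly measurable functions of the training data and of the
observation that is to be classified. -/
abbrev Classifier (d : Fin M → ℕ) (n₁ n₂ : ℕ) : Type :=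
  {Υ : Sample d n₁ n₂ → Tensor d → Bool // Measurable (Function.uncurry Υ)}

/-- `inf_Υ sup_{θ ∈ Θ} P_θ(excess risk of Υ ≥ t)`, the infimum being over all data-driven
classifiers and `P_θ` being the law of the training data. -/
def minimaxProb (p₁ p₂ : ℝ) (n₁ n₂ : ℕ) (Θ : Set (Param d)) (t : ℝ) : ℝ≥0∞ :=
  ⨅ Υ : Classifier d n₁ n₂, ⨆ θ ∈ Θ,
    sampleLaw θ n₁ n₂ {S | t ≤ excessRisk p₁ p₂ θ (Υ.1 S)}

/-- The rate `(∑_m d_m) R / n`. -/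
def rate (d : Fin M → ℕ) (R n : ℕ) : ℝ := (∑ m, (d m : ℝ)) * R / n

end Model

end TGMM

end

/-!
# Minimax lower bounds for the excess risk of tensor discriminant analysis

All parameters used here have identity covariance matrices and means `m ∓ D / 2` with `‖D‖ = Δ`. The
difference of the weighted class densities is then a positive factor, containing `exp (-Δ² / 8)`,
times the hyperbolic sine of half the linear discriminant `⟨D, x - m⟩ + log (p₂ / p₁)`
(`signedDensity_eq`). Hence, if the discriminants of two parameters have opposite signs with margin
`s` on a set `E`, every rule is wrong at each point of `E` for one of the two parameters, and its
two excess risks add up to at least a multiple of `exp (-Δ² / 8) · s · γ(E)`, where `γ` is the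
standard Gaussian measure (`excessRisk_add_ge`).

Two families of parameters are needed.

* *Directions* (`le_minimaxProb_directions`). The tensor `∑ r, e_r ∘ ⋯ ∘ b_r ∘ ⋯ ∘ e_r`, with `b_r` in
  the largest mode `k`, has CP rank `R` for all nonzero `b_r`, and depends isometrically on
  `(b_r)` because there is a second mode. So `D` may range over the points of a hypercube of
  dimension `L = R (d_k - 1)` on the sphere of radius `Δ`, at squared distance `ε L / n` from a
  common centre. Vertices whose Hamming distance exceeds `L / 4` are separated in excess risk by a
  multiple of `exp (-Δ² / 8) L / (n Δ)`, and a Hamming ball of radius `L / 4` contains only an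
  exponentially small fraction of the vertices (`card_hammingBall_le`). This gives failure
  probability `1 - γ` once `L` is large in terms of `γ`.
* *Locations* (`le_minimaxProb_locations`). When `L` is bounded, possibly `0`, the rate is of order
  `1 / n`, and it suffices to move the midpoint `m` along `D` through `N` points at spacing of order
  `1 / (N √n)`, with `N` large in terms of `γ`.

In both cases the sample laws `P_i` are close to a single law `Q`, in the sense that
`P_i(A)² ≤ c Q(A)` with `c` the second moment of the likelihood ratio, which is multiplicative
under products (`L2Dominated`). Since every outcome belongs to at most a fraction `q` of the events
`A_i` that the classifier has small excess risk for parameter `i`, some `A_i` has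
`Q(A_i) ≤ q`, and therefore `P_i(A_i)² ≤ c q ≤ γ²` (`le_minimaxProb_of_family`).

The resulting bound `exists_le_minimaxProb` is of order `exp (-Δ² / 8) / Δ` times the rate for all
`Δ` bounded away from zero. For bounded `Δ` the first factor is a constant; for diverging `Δ` the
denominator is absorbed into `exp (-ϑ Δ²)` with `ϑ = log Δ / Δ²`.
-/

namespace TGMM

/-! ### Standard Gaussian measures on finite products -/

section Gaussian

variable {ι : Type*} [Fintype ι]

/-- The standard Gaussian measure on `ι → ℝ`. -/
noncomputable def stdGauss (ι : Type*) [Fintype ι] : Measure (ι → ℝ) :=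
  Measure.pi fun _ : ι => gaussianReal 0 1

/-- The Gaussian measure on `ι → ℝ` with mean `μ` and identity covariance. -/
noncomputable def gaussAt (μ : ι → ℝ) : Measure (ι → ℝ) :=
  Measure.pi fun i => gaussianReal (μ i) 1

instance : IsProbabilityMeasure (stdGauss ι) := by
  unfold stdGauss; infer_instance

instance (μ : ι → ℝ) : IsProbabilityMeasure (gaussAt μ) := by
  unfold gaussAt; infer_instance

lemma stdGauss_map_add (μ : ι → ℝ) : (stdGauss ι).map (fun z => μ + z) = gaussAt μ := by
  have h := Measure.pi_map_pi (μ := fun _ : ι => gaussianReal 0 1) (f := fun i x => μ i + x)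
    (fun i => by fun_prop)
  simp only [gaussianReal_map_const_add, zero_add] at h
  exact h

lemma gaussAt_map_add (μ ν : ι → ℝ) : (gaussAt μ).map (fun z => ν + z) = gaussAt (ν + μ) := by
  rw [← stdGauss_map_add, ← stdGauss_map_add, Measure.map_map (by fun_prop) (by fun_prop)]
  congr 1
  ext z
  simp [add_assoc]

lemma gaussianReal_eq_withDensity (m : ℝ) :
    gaussianReal m 1 =
      (gaussianReal 0 1).withDensity fun x => ENNReal.ofReal (Real.exp (m * x - m ^ 2 / 2)) := by
  rw [gaussianReal_of_var_ne_zero _ one_ne_zero, gaussianReal_of_var_ne_zero _ one_ne_zero,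
    ← withDensity_mul _ (measurable_gaussianPDF _ _) (by fun_prop)]
  congr 1
  ext x
  simp only [gaussianPDF, Pi.mul_apply, gaussianPDFReal]
  rw [← ENNReal.ofReal_mul (by positivity), mul_assoc (√_)⁻¹, ← Real.exp_add]
  congr 3
  push_cast
  ring

/-- The Cameron–Martin formula. -/
lemma gaussAt_eq_withDensity (μ : ι → ℝ) :
    gaussAt μ =
      (stdGauss ι).withDensity fun x => ENNReal.ofReal (Real.exp (μ ⬝ᵥ x - μ ⬝ᵥ μ / 2)) := by
  refine Measure.pi_eq fun s hs => ?_
  have hexp : ∀ x : ι → ℝ, Real.exp (μ ⬝ᵥ x - μ ⬝ᵥ μ / 2) =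
      ∏ i, Real.exp (μ i * x i - μ i ^ 2 / 2) := fun x => by
    rw [← Real.exp_sum, Finset.sum_sub_distrib, ← Finset.sum_div]
    simp [dotProduct, sq]
  have hint : ∀ i, Integrable (fun x => Real.exp (μ i * x - μ i ^ 2 / 2))
      ((gaussianReal 0 1).restrict (s i)) := fun i => by
    simp_rw [Real.exp_sub]
    exact ((integrable_exp_mul_gaussianReal (μ i)).div_const _).restrict
  rw [withDensity_apply _ (MeasurableSet.univ_pi hs), stdGauss, Measure.restrict_pi_pi]
  simp_rw [hexp]
  rw [← ofReal_integral_eq_lintegral_ofReal (Integrable.fintype_prod hint)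
    (ae_of_all _ fun x => by positivity), integral_fintype_prod_eq_prod
      (f := fun i x => Real.exp (μ i * x - μ i ^ 2 / 2)), ENNReal.ofReal_prod_of_nonneg
      (fun i _ => integral_nonneg fun x => by positivity)]
  refine Finset.prod_congr rfl fun i _ => ?_
  rw [gaussianReal_eq_withDensity (μ i), withDensity_apply _ (hs i),
    ofReal_integral_eq_lintegral_ofReal (hint i) (ae_of_all _ fun x => by positivity)]

/-- Coordinates of a standard Gaussian vector along an orthonormal family are again
standard Gaussian. -/
lemma stdGauss_map_orthonormal {κ : Type*} [Fintype κ] [DecidableEq κ] (w : κ → ι → ℝ)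
    (hw : ∀ k l, w k ⬝ᵥ w l = if k = l then 1 else 0) :
    (stdGauss ι).map (fun x k => w k ⬝ᵥ x) = stdGauss κ := by
  classical
  let L : EuclideanSpace ℝ ι →L[ℝ] EuclideanSpace ℝ κ :=
    Matrix.toEuclideanLin (Matrix.of w) |>.toContinuousLinearMap
  have hL : (stdGaussian (EuclideanSpace ℝ ι)).map L = stdGaussian (EuclideanSpace ℝ κ) := by
    apply Measure.ext_of_charFun
    ext t
    have h1 : ∀ x, Inner.inner ℝ (L x) t = Inner.inner ℝ x (WithLp.toLp 2 (fun i => ∑ k, w k i * t k)) := by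
      intro x
      simp only [L, PiLp.inner_apply, LinearMap.coe_toContinuousLinearMap',
        Matrix.toLpLin_apply, Matrix.mulVec, dotProduct, Matrix.of_apply]
      simp only [RCLike.inner_apply, conj_trivial, Finset.mul_sum, Finset.sum_mul]
      rw [Finset.sum_comm]
      exact Finset.sum_congr rfl fun i _ => Finset.sum_congr rfl fun k _ => by ring
    have h2 : charFun ((stdGaussian (EuclideanSpace ℝ ι)).map L) t =
        charFun (stdGaussian (EuclideanSpace ℝ ι))
          (WithLp.toLp 2 (fun i => ∑ k, w k i * t k)) := by
      rw [charFun_apply, charFun_apply, integral_map (by fun_prop) (by fun_prop)]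
      simp_rw [h1]
    rw [h2, charFun_stdGaussian, charFun_stdGaussian]
    have h3 : ‖(WithLp.toLp 2 (fun i => ∑ k, w k i * t k) : EuclideanSpace ℝ ι)‖ ^ 2
        = ‖t‖ ^ 2 := by
      rw [EuclideanSpace.real_norm_sq_eq, EuclideanSpace.real_norm_sq_eq]
      calc ∑ i, (∑ k, w k i * t k) ^ 2
          = ∑ k, ∑ l, t k * t l * (w k ⬝ᵥ w l) := by
            simp_rw [sq, Finset.sum_mul_sum]
            simp only [dotProduct, Finset.mul_sum]
            rw [Finset.sum_comm]
            refine Finset.sum_congr rfl fun k _ => ?_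
            rw [Finset.sum_comm]
            exact Finset.sum_congr rfl fun l _ => Finset.sum_congr rfl fun i _ => by ring
        _ = ∑ k, t k ^ 2 := by simp [hw, sq]
    norm_cast
    rw [h3]
  rw [← map_pi_eq_stdGaussian, ← map_pi_eq_stdGaussian, Measure.map_map (by fun_prop)
    (by fun_prop)] at hL
  have h4 := congrArg (Measure.map (WithLp.ofLp : EuclideanSpace ℝ κ → κ → ℝ)) hL
  rw [Measure.map_map (by fun_prop) (by fun_prop), Measure.map_map (by fun_prop)
    (by fun_prop)] at h4
  have h5 : (WithLp.ofLp : EuclideanSpace ℝ κ → κ → ℝ) ∘ WithLp.toLp 2 = id := rfl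
  rw [h5, Measure.map_id] at h4
  rw [stdGauss, stdGauss, ← h4]
  congr 1

/-- Orthonormal coordinates of a standard Gaussian vector are independent. -/
lemma stdGauss_real_orthonormal {κ : Type*} [Fintype κ] [DecidableEq κ] (w : κ → ι → ℝ)
    (hw : ∀ k l, w k ⬝ᵥ w l = if k = l then 1 else 0) (A : κ → Set ℝ)
    (hA : ∀ k, MeasurableSet (A k)) :
    (stdGauss ι).real {x | ∀ k, w k ⬝ᵥ x ∈ A k} = ∏ k, (gaussianReal 0 1).real (A k) := by
  have h : {x | ∀ k, w k ⬝ᵥ x ∈ A k} =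
      (fun (x : ι → ℝ) k => w k ⬝ᵥ x) ⁻¹' (Set.univ.pi A) := by
    ext x; simp
  have hm : Measurable (fun (x : ι → ℝ) k => w k ⬝ᵥ x) := by
    unfold dotProduct; fun_prop
  rw [h, measureReal_def, ← Measure.map_apply hm (MeasurableSet.univ_pi hA),
    stdGauss_map_orthonormal w hw, stdGauss, Measure.pi_pi, ENNReal.toReal_prod]
  rfl

lemma gaussianReal_Icc_ge {a b A : ℝ} (ha : -A ≤ a) (hab : a ≤ b) (hb : b ≤ A) :
    (b - a) * (Real.exp (-A ^ 2 / 2) / 3) ≤ (gaussianReal 0 1).real (Set.Icc a b) := by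
  rw [measureReal_def, gaussianReal_apply_eq_integral _ one_ne_zero, ENNReal.toReal_ofReal
    (integral_nonneg fun x => gaussianPDFReal_nonneg _ _ _)]
  have h : ∫ _ in Set.Icc a b, Real.exp (-A ^ 2 / 2) / 3 ≤
      ∫ x in Set.Icc a b, gaussianPDFReal 0 1 x := by
    refine setIntegral_mono_on (by simp) (integrable_gaussianPDFReal 0 1).integrableOn
      measurableSet_Icc fun x hx => ?_
    simp only [gaussianPDFReal, NNReal.coe_one, mul_one, sub_zero]
    have h1 : √(2 * Real.pi) ≤ 3 := by
      rw [Real.sqrt_le_left (by norm_num)]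
      linarith [Real.pi_lt_four]
    have h2 : (3 : ℝ)⁻¹ ≤ (√(2 * Real.pi))⁻¹ := inv_anti₀ (by positivity) h1
    have h3 : x ^ 2 ≤ A ^ 2 := sq_le_sq' (ha.trans hx.1) (hx.2.trans hb)
    rw [div_eq_inv_mul]
    gcongr
  simpa [hab] using h

end Gaussian

/-! ### Second-moment comparison of probability measures -/

section Comparison

/-- `L2Dominated P Q c` says that `(∫ f dP)² ≤ c ∫ f² dQ` for all measurable `f ≥ 0`. For
`P = L • Q` the best constant is `∫ L² dQ = 1 + χ²(P ‖ Q)`; the functional form is used because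
it passes to product measures by Fubini, without any density of the product. -/
def L2Dominated {Ω : Type*} [MeasurableSpace Ω] (P Q : Measure Ω) (c : ℝ≥0∞) : Prop :=
  ∀ f : Ω → ℝ≥0∞, Measurable f → (∫⁻ x, f x ∂P) ^ 2 ≤ c * ∫⁻ x, f x ^ 2 ∂Q

variable {Ω Ω' : Type*} [MeasurableSpace Ω] [MeasurableSpace Ω']

lemma l2Dominated_withDensity (Q : Measure Ω) {L : Ω → ℝ≥0∞} (hL : Measurable L) :
    L2Dominated (Q.withDensity L) Q (∫⁻ x, L x ^ 2 ∂Q) := by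
  intro f hf
  rw [lintegral_withDensity_eq_lintegral_mul _ hL hf]
  have h := ENNReal.lintegral_mul_le_Lp_mul_Lq Q Real.HolderConjugate.two_two
    hL.aemeasurable hf.aemeasurable
  have hsq : ∀ x : ℝ≥0∞, (x ^ (1 / 2 : ℝ)) ^ 2 = x := fun x => by
    rw [← ENNReal.rpow_natCast, ← ENNReal.rpow_mul]; norm_num
  calc (∫⁻ x, (L * f) x ∂Q) ^ 2
      ≤ ((∫⁻ x, L x ^ (2 : ℝ) ∂Q) ^ (1 / 2 : ℝ) * (∫⁻ x, f x ^ (2 : ℝ) ∂Q) ^ (1 / 2 : ℝ)) ^ 2 := by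
        gcongr
    _ = _ := by
        rw [mul_pow, hsq, hsq]
        simp

lemma L2Dominated.map {P Q : Measure Ω} {c : ℝ≥0∞} (h : L2Dominated P Q c) {g : Ω → Ω'}
    (hg : Measurable g) : L2Dominated (P.map g) (Q.map g) c := by
  intro f hf
  rw [lintegral_map hf hg, lintegral_map (hf.pow_const 2) hg]
  exact h _ (hf.comp hg)

lemma L2Dominated.prod {P Q : Measure Ω} {P' Q' : Measure Ω'} [SFinite P'] [SFinite Q']
    {c c' : ℝ≥0∞} (h : L2Dominated P Q c) (h' : L2Dominated P' Q' c') :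
    L2Dominated (P.prod P') (Q.prod Q') (c * c') := by
  intro f hf
  rw [lintegral_prod _ hf.aemeasurable, lintegral_prod _ (hf.pow_const 2).aemeasurable]
  refine (h _ hf.lintegral_prod_right').trans ?_
  rw [mul_assoc]
  gcongr
  rw [← lintegral_const_mul _ (hf.pow_const 2).lintegral_prod_right']
  exact lintegral_mono fun x => h' _ (hf.comp measurable_prodMk_left)

lemma L2Dominated.pi {P Q : Measure Ω} [SigmaFinite P] [SigmaFinite Q] {c : ℝ≥0∞}
    (h : L2Dominated P Q c) (n : ℕ) :
    L2Dominated (Measure.pi fun _ : Fin n => P) (Measure.pi fun _ : Fin n => Q) (c ^ n) := by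
  induction n with
  | zero =>
    intro f _
    have hp : ∀ μ : Measure Ω, Measure.pi (fun _ : Fin 0 => μ) = Measure.dirac (fun i => i.elim0) :=
      fun μ => by
        rw [Measure.pi_of_empty (fun _ : Fin 0 => μ)]
        exact congrArg _ (Subsingleton.elim _ _)
    rw [hp P, hp Q, lintegral_dirac, lintegral_dirac]
    simp
  | succ n ih =>
    have e : ∀ μ : Measure Ω, SigmaFinite μ → Measure.pi (fun _ : Fin (n + 1) => μ) =
        (μ.prod (Measure.pi fun _ : Fin n => μ)).map
          (MeasurableEquiv.piFinSuccAbove (fun _ : Fin (n + 1) => Ω) 0).symm := fun μ _ =>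
      ((measurePreserving_piFinSuccAbove (fun _ : Fin (n + 1) => μ) 0).symm _).map_eq.symm
    rw [e P inferInstance, e Q inferInstance, pow_succ']
    exact (h.prod ih).map (MeasurableEquiv.measurable _)

lemma L2Dominated.measure_sq_le {P Q : Measure Ω} {c : ℝ≥0∞} (h : L2Dominated P Q c) {A : Set Ω}
    (hA : MeasurableSet A) : P A ^ 2 ≤ c * Q A := by
  have := h (A.indicator 1) (measurable_one.indicator hA)
  rw [lintegral_indicator_one hA] at this
  refine this.trans_eq ?_
  have h2 : ∀ x, (A.indicator (1 : Ω → ℝ≥0∞) x) ^ 2 = A.indicator 1 x := fun x => by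
    by_cases hx : x ∈ A <;> simp [hx]
  simp_rw [h2]
  rw [lintegral_indicator_one hA]

/-- If no outcome belongs to more than a fraction `q` of the events `A i`, then some `A i` has
small probability under the law `P i`, as long as all `P i` are close to one law `Q`. -/
lemma exists_measure_sq_le {ι : Type*} [Fintype ι] [Nonempty ι] {P : ι → Measure Ω}
    {Q : Measure Ω} [IsProbabilityMeasure Q] {c q : ℝ≥0∞} (h : ∀ i, L2Dominated (P i) Q c)
    {A : ι → Set Ω} (hA : ∀ i, MeasurableSet (A i))
    (hq : ∀ x, (∑ i, (A i).indicator (1 : Ω → ℝ≥0∞) x) ≤ q * Fintype.card ι) :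
    ∃ i, P i (A i) ^ 2 ≤ c * q := by
  have h1 : ∑ i, Q (A i) ≤ ∑ _i : ι, q := by
    calc ∑ i, Q (A i) = ∑ i, ∫⁻ x, (A i).indicator (1 : Ω → ℝ≥0∞) x ∂Q := by
          simp_rw [lintegral_indicator_one (hA _)]
      _ = ∫⁻ x, ∑ i, (A i).indicator (1 : Ω → ℝ≥0∞) x ∂Q :=
          (lintegral_finsetSum _ fun i _ => measurable_one.indicator (hA i)).symm
      _ ≤ ∫⁻ _, q * Fintype.card ι ∂Q := lintegral_mono hq
      _ = ∑ _i : ι, q := by simp [mul_comm]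
  obtain ⟨i, -, hi⟩ := ENNReal.exists_le_of_sum_le Finset.univ_nonempty h1
  exact ⟨i, ((h i).measure_sq_le (hA i)).trans (by gcongr)⟩

variable {ι : Type*} [Fintype ι]

lemma l2Dominated_gaussAt (μ ν : ι → ℝ) :
    L2Dominated (gaussAt μ) (gaussAt ν)
      (ENNReal.ofReal (Real.exp ((μ - ν) ⬝ᵥ (μ - ν)))) := by
  have key : ∀ a : ι → ℝ, L2Dominated (gaussAt a) (stdGauss ι)
      (ENNReal.ofReal (Real.exp (a ⬝ᵥ a))) := by
    intro a
    have hm : ∀ b : ι → ℝ, Measurable fun x : ι → ℝ =>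
        ENNReal.ofReal (Real.exp (b ⬝ᵥ x - b ⬝ᵥ b / 2)) := fun b => by
      unfold dotProduct; fun_prop
    have h := l2Dominated_withDensity (stdGauss ι) (hm a)
    rw [← gaussAt_eq_withDensity] at h
    convert h using 1
    -- the squared density of `N(a, 1)` is `exp (a ⬝ᵥ a)` times the density of `N(2a, 1)`
    have h2 : ∀ x : ι → ℝ, ENNReal.ofReal (Real.exp (a ⬝ᵥ x - a ⬝ᵥ a / 2)) ^ 2 =
        ENNReal.ofReal (Real.exp (a ⬝ᵥ a)) * ENNReal.ofReal
          (Real.exp (((2 : ℝ) • a) ⬝ᵥ x - ((2 : ℝ) • a) ⬝ᵥ ((2 : ℝ) • a) / 2)) := fun x => by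
      rw [← ENNReal.ofReal_pow (by positivity), ← ENNReal.ofReal_mul (by positivity),
        ← Real.exp_add, ← Real.exp_nat_mul]
      congr 2
      simp only [smul_dotProduct, dotProduct_smul, smul_eq_mul]
      push_cast
      ring
    have h3 := measure_univ (μ := gaussAt ((2 : ℝ) • a))
    rw [gaussAt_eq_withDensity, withDensity_apply _ MeasurableSet.univ,
      Measure.restrict_univ] at h3
    simp_rw [h2]
    rw [lintegral_const_mul _ (hm _), h3, mul_one]
  have h := (key (μ - ν)).map (g := fun z => ν + z) (by fun_prop)
  rwa [gaussAt_map_add, stdGauss_map_add, add_sub_cancel] at h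

end Comparison

/-! ### Excess risk under identity covariance -/

section Excess

variable {M : ℕ} {d : Fin M → ℕ}

/-- The parameter with midpoint `(M₁ + M₂) / 2 = m`, difference `M₂ - M₁ = D` and identity
covariance matrices. -/
noncomputable def isoParam (m D : Tensor d) : Param d where
  mean₁ := m - (1 / 2 : ℝ) • D
  mean₂ := m + (1 / 2 : ℝ) • D
  cov := fun _ => 1

lemma prod_one_apply (I J : ∀ m, Fin (d m)) :
    ∏ m, (1 : Matrix (Fin (d m)) (Fin (d m)) ℝ) (I m) (J m) = if I = J then 1 else 0 := by
  by_cases h : I = J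
  · subst h
    simp [Matrix.one_apply_eq]
  · obtain ⟨m, hm⟩ := Function.ne_iff.mp h
    rw [if_neg h]
    exact Finset.prod_eq_zero (Finset.mem_univ m) (Matrix.one_apply_ne hm)

lemma modeProd_one (X : Tensor d) : modeProd X (fun _ => 1) = X := by
  ext I
  simp [modeProd, prod_one_apply]

lemma kron_one : kron (fun m => (1 : Matrix (Fin (d m)) (Fin (d m)) ℝ)) = 1 := by
  ext I J
  rw [kron, Matrix.of_apply, prod_one_apply, Matrix.one_apply]

open scoped MatrixOrder in
lemma tensorNormal_one (μ : Tensor d) :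
    tensorNormal μ (fun _ => 1) = gaussAt μ := by
  rw [← stdGauss_map_add]
  simp [tensorNormal, CFC.sqrt_one, modeProd_one, stdGauss]

lemma isoParam_diff (m D : Tensor d) : (isoParam m D).diff = D := by
  ext I
  simp only [Param.diff, isoParam, Pi.add_apply, Pi.sub_apply, Pi.smul_apply, smul_eq_mul]
  ring

lemma isoParam_discriminant (m D : Tensor d) : (isoParam m D).discriminant = D := by
  rw [Param.discriminant, isoParam_diff]
  simp [isoParam, modeProd_one]

lemma isoParam_mem {R : ℕ} {C₀ Δ : ℝ} (hC₀ : 1 ≤ C₀) (hΔ : 0 ≤ Δ) {m D : Tensor d}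
    (hD : D ⬝ᵥ D = Δ ^ 2) (hcp : HasCPDecomposition R D) :
    isoParam m D ∈ {θ ∈ paramSpace d R C₀ | θ.snr = Δ} := by
  refine ⟨⟨fun _ => Matrix.PosDef.one, fun l hl => ?_, ?_⟩, ?_⟩
  · have h1 : l = 1 := by
      by_contra hne
      refine hl ?_
      simp only [isoParam, kron_one]
      rw [spectrum.mem_resolventSet_iff,
        ← map_one (algebraMap ℝ (Matrix (∀ m, Fin (d m)) (∀ m, Fin (d m)) ℝ)), ← map_sub]
      exact (IsUnit.mk0 _ (sub_ne_zero.mpr hne)).map _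
    rw [h1]
    exact ⟨inv_le_one_of_one_le₀ hC₀, hC₀⟩
  · rwa [isoParam_discriminant]
  · rw [Param.snr, isoParam_discriminant, isoParam_diff]
    change √(D ⬝ᵥ D) = Δ
    rw [hD, Real.sqrt_sq hΔ]

/-- The density of `N(μ, 1)` with respect to the standard Gaussian measure. -/
noncomputable def gaussDensity {ι : Type*} [Fintype ι] (μ x : ι → ℝ) : ℝ :=
  Real.exp (μ ⬝ᵥ x - μ ⬝ᵥ μ / 2)

lemma gaussDensity_nonneg {ι : Type*} [Fintype ι] (μ x : ι → ℝ) : 0 ≤ gaussDensity μ x :=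
  (Real.exp_pos _).le

lemma measurable_gaussDensity {ι : Type*} [Fintype ι] (μ : ι → ℝ) :
    Measurable (gaussDensity μ) := by
  unfold gaussDensity dotProduct; fun_prop

lemma integrable_gaussDensity {ι : Type*} [Fintype ι] (μ : ι → ℝ) :
    Integrable (gaussDensity μ) (stdGauss ι) := by
  refine ⟨(measurable_gaussDensity μ).aestronglyMeasurable, ?_⟩
  unfold gaussDensity
  rw [hasFiniteIntegral_iff_ofReal (ae_of_all _ fun x => (Real.exp_pos _).le)]
  have h3 := measure_univ (μ := gaussAt μ)
  rw [gaussAt_eq_withDensity, withDensity_apply _ MeasurableSet.univ, Measure.restrict_univ] at h3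
  exact h3.trans_lt ENNReal.one_lt_top

lemma gaussAt_real_eq {ι : Type*} [Fintype ι] (μ : ι → ℝ) {s : Set (ι → ℝ)}
    (hs : MeasurableSet s) : (gaussAt μ).real s = ∫ x in s, gaussDensity μ x ∂stdGauss ι := by
  have h : (gaussAt μ) s = ∫⁻ x in s, ENNReal.ofReal (gaussDensity μ x) ∂stdGauss ι := by
    rw [gaussAt_eq_withDensity, withDensity_apply _ hs]
    rfl
  rw [measureReal_def, h,
    ← ofReal_integral_eq_lintegral_ofReal (integrable_gaussDensity μ).restrict
      (ae_of_all _ fun x => (Real.exp_pos _).le),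
    ENNReal.toReal_ofReal (setIntegral_nonneg hs fun x _ => gaussDensity_nonneg μ x)]

/-- The signed density `p₁ f₁ - p₂ f₂` with respect to the standard Gaussian measure. The Bayes
rule chooses class 2 where it is negative. -/
noncomputable def signedDensity (p₁ p₂ : ℝ) (m D : Tensor d) (x : Tensor d) : ℝ :=
  p₁ * gaussDensity (m - (1 / 2 : ℝ) • D) x - p₂ * gaussDensity (m + (1 / 2 : ℝ) • D) x

lemma measurable_signedDensity (p₁ p₂ : ℝ) (m D : Tensor d) :
    Measurable (signedDensity p₁ p₂ m D) :=
  ((measurable_gaussDensity _).const_mul _).sub ((measurable_gaussDensity _).const_mul _)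

lemma integrable_signedDensity (p₁ p₂ : ℝ) (m D : Tensor d) :
    Integrable (signedDensity p₁ p₂ m D) (stdGauss _) :=
  ((integrable_gaussDensity _).const_mul _).sub ((integrable_gaussDensity _).const_mul _)

lemma risk_isoParam (p₁ p₂ : ℝ) (m D : Tensor d) {Υ : Tensor d → Bool} (hΥ : Measurable Υ) :
    risk p₁ p₂ (isoParam m D) Υ =
      p₂ + ∫ x in {x | Υ x = true}, signedDensity p₁ p₂ m D x ∂stdGauss _ := by
  have hs : MeasurableSet {x | Υ x = true} := hΥ (measurableSet_singleton true)
  have hc : {x | Υ x = false} = {x | Υ x = true}ᶜ := by ext; simp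
  simp only [risk, isoParam, tensorNormal_one, signedDensity]
  rw [hc, probReal_compl_eq_one_sub hs, gaussAt_real_eq _ hs, gaussAt_real_eq _ hs,
    integral_sub ((integrable_gaussDensity _).const_mul _).restrict
      ((integrable_gaussDensity _).const_mul _).restrict, integral_const_mul, integral_const_mul]
  ring

lemma excessRisk_ge_integral {p₁ p₂ : ℝ} (hp₁ : 0 ≤ p₁) (hp₂ : 0 ≤ p₂) (m D : Tensor d)
    {Υ : Tensor d → Bool} (hΥ : Measurable Υ) :
    ∫ x, ({x | Υ x = true}.indicator (signedDensity p₁ p₂ m D) x -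
        {x | signedDensity p₁ p₂ m D x < 0}.indicator (signedDensity p₁ p₂ m D) x) ∂stdGauss _ ≤
      excessRisk p₁ p₂ (isoParam m D) Υ := by
  classical
  have hh := measurable_signedDensity p₁ p₂ m D
  have hi := integrable_signedDensity p₁ p₂ m D
  have hs : MeasurableSet {x | Υ x = true} := hΥ (measurableSet_singleton true)
  have hN : MeasurableSet {x | signedDensity p₁ p₂ m D x < 0} := hh measurableSet_Iio
  have hΨ : Measurable fun x => decide (signedDensity p₁ p₂ m D x < 0) :=
    measurable_to_bool (by simpa [Set.preimage] using hN)
  have hopt : optRisk p₁ p₂ (isoParam m D) ≤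
      risk p₁ p₂ (isoParam m D) fun x => decide (signedDensity p₁ p₂ m D x < 0) := by
    refine ciInf_le (f := fun Υ : {Υ : Tensor d → Bool // Measurable Υ} =>
      risk p₁ p₂ (isoParam m D) Υ.1) ⟨0, ?_⟩ ⟨_, hΨ⟩
    rintro _ ⟨Υ, rfl⟩
    simp only [risk]
    positivity
  rw [risk_isoParam _ _ _ _ hΨ] at hopt
  rw [excessRisk, risk_isoParam _ _ _ _ hΥ, integral_sub (hi.indicator hs) (hi.indicator hN),
    integral_indicator hs, integral_indicator hN]
  simp only [decide_eq_true_eq] at hopt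
  linarith

/-- A rule that chooses class 2 on part of a region where class 1 is more likely, by a margin `b`
of the densities, pays `b` times the measure of that part. -/
lemma excessRisk_ge_of_pos {p₁ p₂ : ℝ} (hp₁ : 0 ≤ p₁) (hp₂ : 0 ≤ p₂) {m D : Tensor d}
    {Υ : Tensor d → Bool} (hΥ : Measurable Υ) {E : Set (Tensor d)} (hE : MeasurableSet E) {b : ℝ}
    (hb : 0 ≤ b) (h : ∀ x ∈ E, b ≤ signedDensity p₁ p₂ m D x) :
    b * (stdGauss _).real (E ∩ {x | Υ x = true}) ≤ excessRisk p₁ p₂ (isoParam m D) Υ := by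
  have hi := integrable_signedDensity p₁ p₂ m D
  have hs : MeasurableSet {x | Υ x = true} := hΥ (measurableSet_singleton true)
  have hN : MeasurableSet {x | signedDensity p₁ p₂ m D x < 0} :=
    measurable_signedDensity p₁ p₂ m D measurableSet_Iio
  refine le_trans ?_ (excessRisk_ge_integral hp₁ hp₂ m D hΥ)
  rw [mul_comm, ← smul_eq_mul, ← integral_indicator_const _ (hE.inter hs)]
  refine integral_mono ((integrable_const b).indicator (hE.inter hs))
    ((hi.indicator hs).sub (hi.indicator hN)) fun x => ?_
  simp only [Set.indicator_apply, Set.mem_ofPred_eq]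
  by_cases hxE : x ∈ E
  · have := h x hxE
    clear h hi
    split_ifs <;> simp_all <;> linarith
  · clear h hi
    split_ifs <;> simp_all [le_of_lt]

/-- A rule that chooses class 1 on part of a region where class 2 is more likely, by a margin `b`
of the densities, pays `b` times the measure of that part. -/
lemma excessRisk_ge_of_neg {p₁ p₂ : ℝ} (hp₁ : 0 ≤ p₁) (hp₂ : 0 ≤ p₂) {m D : Tensor d}
    {Υ : Tensor d → Bool} (hΥ : Measurable Υ) {E : Set (Tensor d)} (hE : MeasurableSet E) {b : ℝ}
    (hb : 0 ≤ b) (h : ∀ x ∈ E, signedDensity p₁ p₂ m D x ≤ -b) :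
    b * (stdGauss _).real (E \ {x | Υ x = true}) ≤ excessRisk p₁ p₂ (isoParam m D) Υ := by
  have hi := integrable_signedDensity p₁ p₂ m D
  have hs : MeasurableSet {x | Υ x = true} := hΥ (measurableSet_singleton true)
  have hN : MeasurableSet {x | signedDensity p₁ p₂ m D x < 0} :=
    measurable_signedDensity p₁ p₂ m D measurableSet_Iio
  refine le_trans ?_ (excessRisk_ge_integral hp₁ hp₂ m D hΥ)
  rw [mul_comm, ← smul_eq_mul, ← integral_indicator_const _ (hE.diff hs)]
  refine integral_mono ((integrable_const b).indicator (hE.diff hs))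
    ((hi.indicator hs).sub (hi.indicator hN)) fun x => ?_
  simp only [Set.indicator_apply, Set.mem_ofPred_eq]
  by_cases hxE : x ∈ E
  · have := h x hxE
    clear h hi
    split_ifs <;> simp_all <;> linarith
  · clear h hi
    split_ifs <;> simp_all [le_of_lt]

/-- The signed density is a positive factor times the hyperbolic sine of the linear discriminant
`⟨D, x - m⟩ + log (p₂ / p₁)`. -/
lemma signedDensity_eq {p₁ p₂ : ℝ} (hp₁ : 0 < p₁) (hp₂ : 0 < p₂) (m D x : Tensor d) :
    signedDensity p₁ p₂ m D x =
      gaussDensity m x * √(p₁ * p₂) * Real.exp (-(D ⬝ᵥ D) / 8) *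
        -(2 * Real.sinh ((D ⬝ᵥ (x - m) + Real.log (p₂ / p₁)) / 2)) := by
  have e1 : √(p₁ * p₂) * Real.exp (-Real.log (p₂ / p₁) / 2) = p₁ := by
    rw [Real.sqrt_eq_rpow, Real.rpow_def_of_pos (by positivity), ← Real.exp_add,
      Real.log_mul hp₁.ne' hp₂.ne', Real.log_div hp₂.ne' hp₁.ne']
    ring_nf
    exact Real.exp_log hp₁
  have e2 : √(p₁ * p₂) * Real.exp (Real.log (p₂ / p₁) / 2) = p₂ := by
    rw [Real.sqrt_eq_rpow, Real.rpow_def_of_pos (by positivity), ← Real.exp_add,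
      Real.log_mul hp₁.ne' hp₂.ne', Real.log_div hp₂.ne' hp₁.ne']
    ring_nf
    exact Real.exp_log hp₂
  have hcomm : D ⬝ᵥ m = m ⬝ᵥ D := dotProduct_comm _ _
  have f1 : gaussDensity (m - (1 / 2 : ℝ) • D) x = gaussDensity m x *
      Real.exp (-(D ⬝ᵥ D) / 8) * Real.exp (-(D ⬝ᵥ (x - m)) / 2) := by
    rw [gaussDensity, gaussDensity, ← Real.exp_add, ← Real.exp_add]
    congr 1
    simp only [sub_dotProduct, dotProduct_sub, smul_dotProduct, dotProduct_smul, smul_eq_mul, hcomm]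
    ring
  have f2 : gaussDensity (m + (1 / 2 : ℝ) • D) x = gaussDensity m x *
      Real.exp (-(D ⬝ᵥ D) / 8) * Real.exp ((D ⬝ᵥ (x - m)) / 2) := by
    rw [gaussDensity, gaussDensity, ← Real.exp_add, ← Real.exp_add]
    congr 1
    simp only [add_dotProduct, dotProduct_add, dotProduct_sub, smul_dotProduct, dotProduct_smul,
      smul_eq_mul, hcomm]
    ring
  have g1 : Real.exp (-((D ⬝ᵥ (x - m) + Real.log (p₂ / p₁)) / 2)) =
      Real.exp (-(D ⬝ᵥ (x - m)) / 2) * Real.exp (-Real.log (p₂ / p₁) / 2) := by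
    rw [← Real.exp_add]; ring_nf
  have g2 : Real.exp ((D ⬝ᵥ (x - m) + Real.log (p₂ / p₁)) / 2) =
      Real.exp ((D ⬝ᵥ (x - m)) / 2) * Real.exp (Real.log (p₂ / p₁) / 2) := by
    rw [← Real.exp_add]; ring_nf
  rw [signedDensity, f1, f2, Real.sinh_eq, g1, g2]
  generalize hP : Real.exp (-Real.log (p₂ / p₁) / 2) = a at *
  generalize hQ : Real.exp (Real.log (p₂ / p₁) / 2) = b at *
  linear_combination (-gaussDensity m x * Real.exp (-(D ⬝ᵥ D) / 8) *
    Real.exp (-(D ⬝ᵥ (x - m)) / 2)) * e1 + (gaussDensity m x * Real.exp (-(D ⬝ᵥ D) / 8) *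
    Real.exp ((D ⬝ᵥ (x - m)) / 2)) * e2

/-- If the linear discriminants of two parameters have opposite signs on `E`, with margin `s`, then
no rule can be good for both parameters: one of the two choices is wrong at each point of `E`. -/
lemma excessRisk_add_ge {p₁ p₂ : ℝ} (hp₁ : 0 < p₁) (hp₂ : 0 < p₂) {m m' D D' : Tensor d} {Δ : ℝ}
    (hD : D ⬝ᵥ D = Δ ^ 2) (hD' : D' ⬝ᵥ D' = Δ ^ 2) {Υ : Tensor d → Bool} (hΥ : Measurable Υ)
    {E : Set (Tensor d)} (hE : MeasurableSet E) {k s : ℝ} (hk : 0 ≤ k) (hs : 0 ≤ s)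
    (hkm : ∀ x ∈ E, k ≤ gaussDensity m x) (hkm' : ∀ x ∈ E, k ≤ gaussDensity m' x)
    (h : ∀ x ∈ E, s ≤ D ⬝ᵥ (x - m) + Real.log (p₂ / p₁))
    (h' : ∀ x ∈ E, D' ⬝ᵥ (x - m') + Real.log (p₂ / p₁) ≤ -s) :
    k * √(p₁ * p₂) * Real.exp (-Δ ^ 2 / 8) * s * (stdGauss _).real E ≤
      excessRisk p₁ p₂ (isoParam m D) Υ + excessRisk p₁ p₂ (isoParam m' D') Υ := by
  set b := k * √(p₁ * p₂) * Real.exp (-Δ ^ 2 / 8) * s with hb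
  have hb0 : 0 ≤ b := by positivity
  have hsE : MeasurableSet {x | Υ x = true} := hΥ (measurableSet_singleton true)
  have hsinh : ∀ y, s ≤ y → s ≤ 2 * Real.sinh (y / 2) := fun y hy => by
    have := Real.self_le_sinh_iff.mpr (by linarith : 0 ≤ y / 2)
    linarith
  have h1 := excessRisk_ge_of_neg hp₁.le hp₂.le (m := m) (D := D) hΥ hE hb0 fun x hx => by
    have h3 := hkm x hx
    have h4 := hsinh _ (h x hx)
    have h5 : 0 ≤ gaussDensity m x := hk.trans h3
    rw [signedDensity_eq hp₁ hp₂, hD, mul_neg, neg_le_neg_iff, hb]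
    gcongr
  have h2 := excessRisk_ge_of_pos hp₁.le hp₂.le (m := m') (D := D') hΥ hE hb0 fun x hx => by
    have h3 := hkm' x hx
    have h4 := hsinh _ (le_neg.mpr (h' x hx))
    have h5 : 0 ≤ gaussDensity m' x := hk.trans h3
    rw [signedDensity_eq hp₁ hp₂, hD', hb, ← mul_neg, ← Real.sinh_neg, ← neg_div]
    gcongr
  have h3 := measureReal_inter_add_sdiff (μ := stdGauss _) (s := E) hsE
  rw [← h3]
  linarith

end Excess

/-! ### From a finite family of parameters to the minimax probability -/

section Reduction

variable {M : ℕ} {d : Fin M → ℕ}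

instance isProbabilityMeasure_tensorNormal (μ : Tensor d) (S : ModeMatrices d) :
    IsProbabilityMeasure (tensorNormal μ S) := by
  unfold tensorNormal
  refine Measure.isProbabilityMeasure_map (Measurable.aemeasurable ?_)
  unfold modeProd
  fun_prop

instance isProbabilityMeasure_sampleLaw (θ : Param d) (n₁ n₂ : ℕ) :
    IsProbabilityMeasure (sampleLaw θ n₁ n₂) := by
  unfold sampleLaw; infer_instance

lemma l2Dominated_sampleLaw (m D m₀ D₀ : Tensor d) (n₁ n₂ : ℕ) {v : ℝ}
    (h₁ : ((isoParam m D).mean₁ - (isoParam m₀ D₀).mean₁) ⬝ᵥ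
      ((isoParam m D).mean₁ - (isoParam m₀ D₀).mean₁) ≤ v)
    (h₂ : ((isoParam m D).mean₂ - (isoParam m₀ D₀).mean₂) ⬝ᵥ
      ((isoParam m D).mean₂ - (isoParam m₀ D₀).mean₂) ≤ v) :
    L2Dominated (sampleLaw (isoParam m D) n₁ n₂) (sampleLaw (isoParam m₀ D₀) n₁ n₂)
      (ENNReal.ofReal (Real.exp ((n₁ + n₂) * v))) := by
  have key : ∀ μ ν : Tensor d, (μ - ν) ⬝ᵥ (μ - ν) ≤ v →
      L2Dominated (tensorNormal μ fun _ => 1) (tensorNormal ν fun _ => 1)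
        (ENNReal.ofReal (Real.exp v)) := fun μ ν h f hf => by
    rw [tensorNormal_one, tensorNormal_one]
    refine (l2Dominated_gaussAt μ ν f hf).trans ?_
    gcongr
  have h := ((key _ _ h₁).pi n₁).prod ((key _ _ h₂).pi n₂)
  rw [← pow_add, ← ENNReal.ofReal_pow (by positivity), ← Real.exp_nat_mul, Nat.cast_add] at h
  exact h

lemma measurable_excessRisk (p₁ p₂ : ℝ) (θ : Param d) {n₁ n₂ : ℕ} (Υ : Classifier d n₁ n₂) :
    Measurable fun S => excessRisk p₁ p₂ θ (Υ.1 S) := by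
  have key : ∀ (μ : Tensor d) (b : Bool),
      Measurable fun S => (tensorNormal μ θ.cov).real {x | Υ.1 S x = b} := fun μ b =>
    (measurable_measure_prodMk_left (ν := tensorNormal μ θ.cov)
      (Υ.2 (measurableSet_singleton b))).ennreal_toReal
  unfold excessRisk risk
  exact (((key _ _).const_mul _).add ((key _ _).const_mul _)).sub_const _

open Classical in
/-- The minimax probability is close to one as soon as there is a finite family of parameters such
that their sample laws are close to a single law (up to `exp ((n₁ + n₂) v)` in second moment) and
every fixed rule has small excess risk for at most a fraction `q` of the family. -/
lemma le_minimaxProb_of_family {ι : Type*} [Fintype ι] [Nonempty ι] (p₁ p₂ : ℝ) (n₁ n₂ : ℕ)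
    (m D : ι → Tensor d) (m₀ D₀ : Tensor d) {Θ : Set (Param d)}
    (hΘ : ∀ i, isoParam (m i) (D i) ∈ Θ) {v q γ t : ℝ}
    (h₁ : ∀ i, ((isoParam (m i) (D i)).mean₁ - (isoParam m₀ D₀).mean₁) ⬝ᵥ
      ((isoParam (m i) (D i)).mean₁ - (isoParam m₀ D₀).mean₁) ≤ v)
    (h₂ : ∀ i, ((isoParam (m i) (D i)).mean₂ - (isoParam m₀ D₀).mean₂) ⬝ᵥ
      ((isoParam (m i) (D i)).mean₂ - (isoParam m₀ D₀).mean₂) ≤ v)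
    (hcount : ∀ Υ : Tensor d → Bool, Measurable Υ →
      ((Finset.univ.filter fun i => excessRisk p₁ p₂ (isoParam (m i) (D i)) Υ < t).card : ℝ) ≤
        q * Fintype.card ι)
    (hγ : 0 ≤ γ) (hq0 : 0 ≤ q) (hq : Real.exp ((n₁ + n₂) * v) * q ≤ γ ^ 2) :
    ENNReal.ofReal (1 - γ) ≤ minimaxProb p₁ p₂ n₁ n₂ Θ t := by
  refine le_iInf fun Υ => ?_
  have hA : ∀ i, MeasurableSet {S | excessRisk p₁ p₂ (isoParam (m i) (D i)) (Υ.1 S) < t} :=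
    fun i => measurable_excessRisk p₁ p₂ _ Υ measurableSet_Iio
  obtain ⟨i, hi⟩ := exists_measure_sq_le (q := ENNReal.ofReal q)
    (fun i => l2Dominated_sampleLaw (m i) (D i) m₀ D₀ n₁ n₂ (h₁ i) (h₂ i)) hA fun S => by
      have hc := hcount (Υ.1 S) (Υ.2.comp measurable_prodMk_left)
      have e : ∑ i, ({S | excessRisk p₁ p₂ (isoParam (m i) (D i)) (Υ.1 S) < t}.indicator
          (1 : Sample d n₁ n₂ → ℝ≥0∞) S) =
          ((Finset.univ.filter fun i =>
            excessRisk p₁ p₂ (isoParam (m i) (D i)) (Υ.1 S) < t).card : ℝ≥0∞) := by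
        simp [Set.indicator_apply, Finset.sum_boole]
      rw [e, ← ENNReal.ofReal_natCast, ← ENNReal.ofReal_natCast, ← ENNReal.ofReal_mul hq0]
      exact ENNReal.ofReal_le_ofReal hc
  refine le_trans ?_ (le_iSup₂ (isoParam (m i) (D i)) (hΘ i))
  have hcompl : {S | t ≤ excessRisk p₁ p₂ (isoParam (m i) (D i)) (Υ.1 S)} =
      {S | excessRisk p₁ p₂ (isoParam (m i) (D i)) (Υ.1 S) < t}ᶜ := by
    ext S; simp
  rw [hcompl, prob_compl_eq_one_sub (hA i), ENNReal.ofReal_sub _ hγ, ENNReal.ofReal_one]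
  gcongr
  rw [← ENNReal.ofReal_mul (by positivity)] at hi
  refine (ENNReal.pow_le_pow_left_iff two_ne_zero).mp ?_
  rw [← ENNReal.ofReal_pow hγ]
  exact hi.trans (ENNReal.ofReal_le_ofReal hq)

lemma minimaxProb_antitone (p₁ p₂ : ℝ) (n₁ n₂ : ℕ) (Θ : Set (Param d)) :
    Antitone (minimaxProb p₁ p₂ n₁ n₂ Θ) := fun s t hst => by
  unfold minimaxProb
  gcongr with Υ θ hθ

end Reduction

/-! ### Pairs of parameters that no rule can serve simultaneously -/

section Separation

variable {M : ℕ} {d : Fin M → ℕ}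

/-- The constant in `excessRisk_add_ge_directions`. -/
noncomputable def directionConst (p₁ p₂ c₁ : ℝ) : ℝ :=
  √(p₁ * p₂) * (Real.exp (-2 ^ 2 / 2) / 3) *
    (Real.exp (-(2 * |Real.log (p₂ / p₁)| / c₁ + 1) ^ 2 / 2) / 3) / 2

/-- The constant in `excessRisk_add_ge_locations`. -/
noncomputable def locationConst (p₁ p₂ c₁ : ℝ) : ℝ :=
  Real.exp (-(|Real.log (p₂ / p₁)| / c₁ + 2)) * √(p₁ * p₂) *
    (Real.exp (-(|Real.log (p₂ / p₁)| / c₁ + 1) ^ 2 / 2) / 3) / 8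

lemma directionConst_pos {p₁ p₂ : ℝ} (hp₁ : 0 < p₁) (hp₂ : 0 < p₂) (c₁ : ℝ) :
    0 < directionConst p₁ p₂ c₁ := by
  unfold directionConst; positivity

lemma locationConst_pos {p₁ p₂ : ℝ} (hp₁ : 0 < p₁) (hp₂ : 0 < p₂) (c₁ : ℝ) :
    0 < locationConst p₁ p₂ c₁ := by
  unfold locationConst; positivity

/-- Two parameters with midpoint zero whose differences `D`, `D'` have the same norm `Δ` and
distance `2 η`: no rule has small excess risk for both. The linear discriminants have opposite signs
with margin `η / 2` when the component of the observation along `D + D'` is within `η / 2` of the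
boundary and the component along `D - D'` lies in `[1, 2]`. -/
lemma excessRisk_add_ge_directions {p₁ p₂ : ℝ} (hp₁ : 0 < p₁) (hp₂ : 0 < p₂) {c₁ Δ η : ℝ}
    (hc₁ : 0 < c₁) (hΔ : c₁ ≤ Δ) (hη : 0 < η) (hηΔ : 2 * η ^ 2 ≤ Δ ^ 2) {D D' : Tensor d}
    (hD : D ⬝ᵥ D = Δ ^ 2) (hD' : D' ⬝ᵥ D' = Δ ^ 2)
    (hDD' : D ⬝ᵥ D' = Δ ^ 2 - 2 * η ^ 2)
    {Υ : Tensor d → Bool} (hΥ : Measurable Υ) :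
    directionConst p₁ p₂ c₁ * (Real.exp (-Δ ^ 2 / 8) * η ^ 2 / Δ) ≤
      excessRisk p₁ p₂ (isoParam 0 D) Υ + excessRisk p₁ p₂ (isoParam 0 D') Υ := by
  have hΔ0 : 0 < Δ := hc₁.trans_le hΔ
  set β := Real.log (p₂ / p₁) with hβ
  set s := √(Δ ^ 2 - η ^ 2) with hs
  have hs2 : s ^ 2 = Δ ^ 2 - η ^ 2 := Real.sq_sqrt (by nlinarith)
  have hs0 : 0 < s := Real.sqrt_pos.mpr (by nlinarith)
  have hsΔ : s ≤ Δ := abs_le_of_sq_le_sq' (by nlinarith) hΔ0.le |>.2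
  have hηs : η ≤ s := abs_le_of_sq_le_sq' (by nlinarith) hs0.le |>.2
  have hΔs : Δ ≤ 2 * s := abs_le_of_sq_le_sq' (by nlinarith) (by positivity) |>.2
  set u : Tensor d := (2 * s)⁻¹ • (D + D') with hu
  set v : Tensor d := (2 * η)⁻¹ • (D - D') with hv
  have hcomm : D' ⬝ᵥ D = D ⬝ᵥ D' := dotProduct_comm _ _
  have huu : u ⬝ᵥ u = 1 := by
    simp only [hu, smul_dotProduct, dotProduct_smul, add_dotProduct, dotProduct_add, hD, hD', hDD',
      hcomm, smul_eq_mul]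
    field_simp
    linarith
  have hvv : v ⬝ᵥ v = 1 := by
    simp only [hv, smul_dotProduct, dotProduct_smul, sub_dotProduct, dotProduct_sub, hD, hD', hDD',
      hcomm, smul_eq_mul]
    field_simp
    ring
  have huv : u ⬝ᵥ v = 0 := by
    simp only [hu, hv, smul_dotProduct, dotProduct_smul, add_dotProduct, dotProduct_sub, hD, hD',
      hDD', hcomm, smul_eq_mul]
    ring
  have hvu : v ⬝ᵥ u = 0 := by rw [dotProduct_comm, huv]
  have hDuv : D = s • u + η • v := by
    ext I
    simp only [hu, hv, Pi.add_apply, Pi.smul_apply, Pi.sub_apply, smul_eq_mul]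
    field_simp
    ring
  have hDuv' : D' = s • u - η • v := by
    ext I
    simp only [hu, hv, Pi.add_apply, Pi.smul_apply, Pi.sub_apply, smul_eq_mul]
    field_simp
    ring
  clear_value u v
  have hDx : ∀ x, D ⬝ᵥ x = s * (u ⬝ᵥ x) + η * (v ⬝ᵥ x) := fun x => by
    rw [hDuv, add_dotProduct, smul_dotProduct, smul_dotProduct, smul_eq_mul, smul_eq_mul]
  have hDx' : ∀ x, D' ⬝ᵥ x = s * (u ⬝ᵥ x) - η * (v ⬝ᵥ x) := fun x => by
    rw [hDuv', sub_dotProduct, smul_dotProduct, smul_dotProduct, smul_eq_mul, smul_eq_mul]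
  let A : Fin 2 → Set ℝ := ![Set.Icc ((-β - η / 2) / s) ((-β + η / 2) / s), Set.Icc 1 2]
  have hA : ∀ k, MeasurableSet (A k) := fun k => by
    fin_cases k <;> exact measurableSet_Icc
  have hE : MeasurableSet {x : Tensor d | ∀ k, ![u, v] k ⬝ᵥ x ∈ A k} := by
    have : {x : Tensor d | ∀ k, ![u, v] k ⬝ᵥ x ∈ A k} = ⋂ k, {x | ![u, v] k ⬝ᵥ x ∈ A k} := by
      ext x; simp
    rw [this]
    refine MeasurableSet.iInter fun k => ?_
    have hm : Measurable fun x : Tensor d => ![u, v] k ⬝ᵥ x := by unfold dotProduct; fun_prop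
    exact hm (hA k)
  have hprob := stdGauss_real_orthonormal ![u, v] (fun k l => by
    fin_cases k <;> fin_cases l <;> simp [huu, hvv, huv, hvu]) A hA
  have hEx : ∀ x ∈ {x : Tensor d | ∀ k, ![u, v] k ⬝ᵥ x ∈ A k},
      -(η / 2) ≤ s * (u ⬝ᵥ x) + β ∧ s * (u ⬝ᵥ x) + β ≤ η / 2 ∧ η ≤ η * (v ⬝ᵥ x) := fun x hx => by
    have h0 : u ⬝ᵥ x ∈ Set.Icc ((-β - η / 2) / s) ((-β + η / 2) / s) := hx 0
    have h1 : v ⬝ᵥ x ∈ Set.Icc (1 : ℝ) 2 := hx 1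
    have h2 := (div_le_iff₀ hs0).mp h0.1
    have h3 := (le_div_iff₀ hs0).mp h0.2
    exact ⟨by linarith, by linarith, le_mul_of_one_le_right hη.le h1.1⟩
  have hmain := excessRisk_add_ge hp₁ hp₂ (m := 0) (m' := 0) hD hD' hΥ hE (k := 1) (s := η / 2)
    zero_le_one (by positivity) (fun x _ => by simp [gaussDensity])
    (fun x _ => by simp [gaussDensity])
    (fun x hx => by
      obtain ⟨h1, -, h3⟩ := hEx x hx
      rw [sub_zero, hDx]
      linarith)
    (fun x hx => by
      obtain ⟨-, h2, h3⟩ := hEx x hx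
      rw [sub_zero, hDx']
      linarith)
  refine le_trans ?_ hmain
  rw [hprob, Fin.prod_univ_two]
  have hβs : |β| / s ≤ 2 * |β| / c₁ := by
    rw [div_le_div_iff₀ hs0 hc₁]
    nlinarith [abs_nonneg β]
  have hηs' : η / s ≤ 1 := (div_le_one hs0).mpr hηs
  have hβ1 : -(|β| / s) ≤ β / s := by
    rw [← neg_div]; gcongr; exact neg_abs_le β
  have hβ2 : β / s ≤ |β| / s := by
    gcongr; exact le_abs_self β
  have e1 : (-β - η / 2) / s = -(β / s) - η / s / 2 := by ring
  have e2 : (-β + η / 2) / s = -(β / s) + η / s / 2 := by ring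
  have hηs0 : 0 < η / s := by positivity
  have g0 := gaussianReal_Icc_ge (a := (-β - η / 2) / s) (b := (-β + η / 2) / s)
    (A := 2 * |β| / c₁ + 1) (by rw [e1]; linarith) (by rw [e1, e2]; linarith)
    (by rw [e2]; linarith)
  have g1 := gaussianReal_Icc_ge (a := 1) (b := 2) (A := 2) (by norm_num) (by norm_num) le_rfl
  have g2 : η / Δ ≤ (-β + η / 2) / s - (-β - η / 2) / s := by
    have : η / Δ ≤ η / s := by gcongr
    rw [e1, e2]; linarith
  calc directionConst p₁ p₂ c₁ * (Real.exp (-Δ ^ 2 / 8) * η ^ 2 / Δ)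
      = 1 * √(p₁ * p₂) * Real.exp (-Δ ^ 2 / 8) * (η / 2) *
        ((η / Δ * (Real.exp (-(2 * |β| / c₁ + 1) ^ 2 / 2) / 3)) *
          ((2 - 1) * (Real.exp (-2 ^ 2 / 2) / 3))) := by
        rw [directionConst, ← hβ]; ring
    _ ≤ _ := by
        gcongr
        · exact (by gcongr : _ ≤ _).trans g0
        · exact g1

/-- Two parameters with the same difference `D` and midpoints `t D / Δ`, `t' D / Δ`: the linear
discriminants have opposite signs when the component of the observation along `D` lies between the
two boundaries. -/
lemma excessRisk_add_ge_locations {p₁ p₂ : ℝ} (hp₁ : 0 < p₁) (hp₂ : 0 < p₂) {c₁ Δ t t' : ℝ}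
    (hc₁ : 0 < c₁) (hΔ : c₁ ≤ Δ) (ht : 0 ≤ t) (htt' : t < t') (ht' : t' ≤ 1) {D : Tensor d}
    (hD : D ⬝ᵥ D = Δ ^ 2) {Υ : Tensor d → Bool} (hΥ : Measurable Υ) :
    locationConst p₁ p₂ c₁ * (Real.exp (-Δ ^ 2 / 8) * Δ * (t' - t) ^ 2) ≤
      excessRisk p₁ p₂ (isoParam ((t / Δ) • D) D) Υ +
        excessRisk p₁ p₂ (isoParam ((t' / Δ) • D) D) Υ := by
  have hΔ0 : 0 < Δ := hc₁.trans_le hΔ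
  set β := Real.log (p₂ / p₁) with hβ
  set u : Tensor d := Δ⁻¹ • D with hu
  have huu : u ⬝ᵥ u = 1 := by
    simp only [hu, smul_dotProduct, dotProduct_smul, hD, smul_eq_mul]
    field_simp
  have hm : ∀ a : ℝ, (a / Δ) • D = a • u := fun a => by rw [hu, smul_smul, div_eq_mul_inv]
  have hDu : D = Δ • u := by rw [hu, smul_smul, mul_inv_cancel₀ hΔ0.ne', one_smul]
  clear_value u
  have hDx : ∀ x, D ⬝ᵥ x = Δ * (u ⬝ᵥ x) := fun x => by
    rw [hDu, smul_dotProduct, smul_eq_mul]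
  have hβΔ : |β / Δ| ≤ |β| / c₁ := by
    rw [abs_div, abs_of_pos hΔ0]; gcongr
  obtain ⟨hβ1, hβ2⟩ := abs_le.mp hβΔ
  set h := (t' - t) / 4 with hh
  have hh0 : 0 < h := by rw [hh]; linarith
  set a := t - β / Δ + h with ha
  set b := t' - β / Δ - h with hb
  have hprob := stdGauss_real_orthonormal (fun _ : Unit => u) (fun _ _ => by simp [huu])
    (fun _ => Set.Icc a b) (fun _ => measurableSet_Icc)
  have hE : MeasurableSet {x : Tensor d | ∀ _k : Unit, u ⬝ᵥ x ∈ Set.Icc a b} := by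
    have hm : Measurable fun x : Tensor d => u ⬝ᵥ x := by unfold dotProduct; fun_prop
    have e : {x : Tensor d | ∀ _k : Unit, u ⬝ᵥ x ∈ Set.Icc a b} =
        (fun x : Tensor d => u ⬝ᵥ x) ⁻¹' Set.Icc a b := by ext x; simp
    rw [e]
    exact hm measurableSet_Icc
  have hdens : ∀ r, 0 ≤ r → r ≤ 1 → ∀ x ∈ {x : Tensor d | ∀ _k : Unit, u ⬝ᵥ x ∈ Set.Icc a b},
      Real.exp (-(|β| / c₁ + 2)) ≤ gaussDensity ((r / Δ) • D) x := fun r hr hr1 x hx => by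
    obtain ⟨h1, h2⟩ := hx ()
    rw [hm, gaussDensity]
    gcongr
    simp only [smul_dotProduct, dotProduct_smul, huu, smul_eq_mul, mul_one]
    have hX : -(|β| / c₁ + 1) ≤ u ⬝ᵥ x := by linarith
    have h0 : 0 ≤ |β| / c₁ + 1 := by positivity
    nlinarith
  have hmain := excessRisk_add_ge hp₁ hp₂ hD hD hΥ hE (Real.exp_pos _).le (s := Δ * h)
    (by positivity) (hdens t ht (by linarith)) (hdens t' (by linarith) ht')
    (fun x hx => by
      obtain ⟨h1, h2⟩ := hx ()
      rw [hm, dotProduct_sub, dotProduct_smul, smul_eq_mul, hDx, hDx, huu, mul_one]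
      have h3 := mul_le_mul_of_nonneg_left h1 hΔ0.le
      have h4 : Δ * a = Δ * t - β + Δ * h := by rw [ha]; field_simp
      rw [← hβ]
      linarith)
    (fun x hx => by
      obtain ⟨h1, h2⟩ := hx ()
      rw [hm, dotProduct_sub, dotProduct_smul, smul_eq_mul, hDx, hDx, huu, mul_one]
      have h3 := mul_le_mul_of_nonneg_left h2 hΔ0.le
      have h4 : Δ * b = Δ * t' - β - Δ * h := by rw [hb]; field_simp
      rw [← hβ]
      linarith)
  refine le_trans ?_ hmain
  have g := gaussianReal_Icc_ge (a := a) (b := b) (A := |β| / c₁ + 1) (by linarith) (by linarith)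
    (by linarith)
  simp only [Finset.univ_unique, Finset.prod_const, Finset.card_singleton, pow_one] at hprob
  rw [hprob]
  calc locationConst p₁ p₂ c₁ * (Real.exp (-Δ ^ 2 / 8) * Δ * (t' - t) ^ 2)
      = Real.exp (-(|β| / c₁ + 2)) * √(p₁ * p₂) * Real.exp (-Δ ^ 2 / 8) * (Δ * h) *
        ((b - a) * (Real.exp (-(|β| / c₁ + 1) ^ 2 / 2) / 3)) := by
        rw [locationConst, ← hβ, ha, hb, hh]; ring
    _ ≤ _ := by gcongr

end Separation

/-! ### Hamming balls in the hypercube -/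

section Hypercube

variable {α : Type*} [Fintype α]

/-- A Hamming ball of radius a quarter of the dimension is an exponentially small part of the
hypercube. -/
lemma card_hammingBall_le [DecidableEq α] (σ₀ : α → Bool) :
    ((Finset.univ.filter fun σ : α → Bool => 4 * hammingDist σ σ₀ ≤ Fintype.card α).card : ℝ) ≤
      (337 / 192) ^ Fintype.card α := by
  -- Chernoff's bound: the indicator is at most `(4/3) ^ (L - 4 H)`, whose sum factorizes
  have h1 : ∀ σ : α → Bool, (81 / 256 : ℝ) ^ hammingDist σ σ₀ =
      ∏ a, if σ a ≠ σ₀ a then (81 / 256 : ℝ) else 1 := fun σ => by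
    rw [hammingDist, Finset.prod_ite]
    simp [div_pow]
  have h2 : ∑ σ : α → Bool, (81 / 256 : ℝ) ^ hammingDist σ σ₀ =
      (337 / 256) ^ Fintype.card α := by
    simp_rw [h1]
    have := Finset.prod_univ_sum (fun _ : α => (Finset.univ : Finset Bool))
      (fun a b => if b ≠ σ₀ a then (81 / 256 : ℝ) else 1)
    rw [Fintype.piFinset_univ] at this
    rw [← this]
    have h3 : ∀ a, ∑ b : Bool, (if b ≠ σ₀ a then (81 / 256 : ℝ) else 1) = 337 / 256 := fun a => by
      cases σ₀ a <;> norm_num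
    rw [Finset.prod_congr rfl fun a _ => h3 a, Finset.prod_const, Finset.card_univ]
  calc ((Finset.univ.filter fun σ : α → Bool => 4 * hammingDist σ σ₀ ≤ Fintype.card α).card : ℝ)
      = ∑ σ ∈ Finset.univ.filter fun σ : α → Bool => 4 * hammingDist σ σ₀ ≤ Fintype.card α,
          (1 : ℝ) := by simp
    _ ≤ ∑ σ ∈ Finset.univ.filter fun σ : α → Bool => 4 * hammingDist σ σ₀ ≤ Fintype.card α,
          (4 / 3 : ℝ) ^ Fintype.card α * (81 / 256 : ℝ) ^ hammingDist σ σ₀ := by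
        refine Finset.sum_le_sum fun σ hσ => ?_
        have hle := (Finset.mem_filter.mp hσ).2
        have e : (81 / 256 : ℝ) ^ hammingDist σ σ₀ = ((4 / 3 : ℝ) ^ (4 * hammingDist σ σ₀))⁻¹ := by
          rw [pow_mul, ← inv_pow]; norm_num
        rw [e, ← div_eq_mul_inv, one_le_div (by positivity)]
        exact pow_le_pow_right₀ (by norm_num) hle
    _ ≤ ∑ σ : α → Bool, (4 / 3 : ℝ) ^ Fintype.card α * (81 / 256 : ℝ) ^ hammingDist σ σ₀ :=
        Finset.sum_le_sum_of_subset_of_nonneg (Finset.filter_subset _ _)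
          fun _ _ _ => by positivity
    _ = (337 / 192) ^ Fintype.card α := by
        rw [← Finset.mul_sum, h2, ← mul_pow]; norm_num

/-- The sign `±1` encoded by a Boolean. -/
def sign (b : Bool) : ℝ := if b then 1 else -1

lemma sum_sign_mul_sign (σ σ' : α → Bool) :
    ∑ a, sign (σ a) * sign (σ' a) = Fintype.card α - 2 * hammingDist σ σ' := by
  have h : ∀ a, sign (σ a) * sign (σ' a) = 1 - 2 * (if σ a ≠ σ' a then 1 else 0) := fun a => by
    cases σ a <;> cases σ' a <;> norm_num [sign]
  simp_rw [h, Finset.sum_sub_distrib, ← Finset.mul_sum, Finset.sum_boole]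
  simp [hammingDist]

end Hypercube

/-! ### An isometric family of tensors with prescribed CP rank -/

section Embedding

variable {M : ℕ} {d : Fin M → ℕ} {R : ℕ}

/-- The mode vectors of the `r`-th rank-one term of `cpEmbed`: the vector `x` in mode `k` and the
`r`-th standard basis vector in all other modes. -/
def modeVec (hR : ∀ m, R ≤ d m) (k : Fin M) (r : Fin R) (x : Fin (d k) → ℝ) :
    ∀ m, Fin (d m) → ℝ :=
  Function.update (fun m => Pi.single (Fin.castLE (hR m) r) 1) k x

/-- The tensor `∑ r, e_r ∘ ⋯ ∘ b_r ∘ ⋯ ∘ e_r`, where `b_r` is in mode `k`. -/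
def cpEmbed (hR : ∀ m, R ≤ d m) (k : Fin M) (b : Fin R → Fin (d k) → ℝ) : Tensor d :=
  fun I => ∑ r, ∏ m, modeVec hR k r (b r) m (I m)

lemma hasCPDecomposition_cpEmbed (hR : ∀ m, R ≤ d m) (k : Fin M) (b : Fin R → Fin (d k) → ℝ)
    (hb : ∀ r, 0 < b r ⬝ᵥ b r) : HasCPDecomposition R (cpEmbed hR k b) := by
  refine ⟨fun r => √(b r ⬝ᵥ b r), fun r => modeVec hR k r ((√(b r ⬝ᵥ b r))⁻¹ • b r),
    fun r => Real.sqrt_pos.mpr (hb r), fun r m => ?_, fun I => ?_⟩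
  · by_cases hm : m = k
    · subst hm
      simp only [modeVec, Function.update_self, Pi.smul_apply, smul_eq_mul, mul_pow, inv_pow]
      rw [← Finset.mul_sum, Real.sq_sqrt (hb r).le]
      have : ∑ i, b r i ^ 2 = b r ⬝ᵥ b r := by simp [dotProduct, sq]
      rw [this, inv_mul_cancel₀ (hb r).ne']
    · simp [modeVec, Function.update_of_ne hm, Pi.single_apply]
  · refine Finset.sum_congr rfl fun r _ => ?_
    have hne : √(b r ⬝ᵥ b r) ≠ 0 := (Real.sqrt_pos.mpr (hb r)).ne'
    rw [← Finset.mul_prod_erase _ _ (Finset.mem_univ k),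
      ← Finset.mul_prod_erase Finset.univ
        (fun m => modeVec hR k r ((√(b r ⬝ᵥ b r))⁻¹ • b r) m (I m)) (Finset.mem_univ k)]
    simp only [modeVec, Function.update_self, Pi.smul_apply, smul_eq_mul]
    rw [← mul_assoc, ← mul_assoc, mul_inv_cancel₀ hne, one_mul]
    congr 1
    refine Finset.prod_congr rfl fun m hm => ?_
    rw [Function.update_of_ne (Finset.ne_of_mem_erase hm),
      Function.update_of_ne (Finset.ne_of_mem_erase hm)]

/-- `cpEmbed` is isometric. Since there are at least two modes, different terms are orthogonal in a
mode other than `k`. -/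
lemma cpEmbed_dotProduct (hM : 2 ≤ M) (hR : ∀ m, R ≤ d m) (k : Fin M)
    (b b' : Fin R → Fin (d k) → ℝ) :
    cpEmbed hR k b ⬝ᵥ cpEmbed hR k b' = ∑ r, b r ⬝ᵥ b' r := by
  have h1 : cpEmbed hR k b ⬝ᵥ cpEmbed hR k b' =
      ∑ r, ∑ s, ∏ m, (modeVec hR k r (b r) m ⬝ᵥ modeVec hR k s (b' s) m) := by
    simp only [dotProduct, cpEmbed, Finset.sum_mul_sum, ← Finset.prod_mul_distrib]
    rw [Finset.sum_comm]
    refine Finset.sum_congr rfl fun r _ => ?_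
    rw [Finset.sum_comm]
    refine Finset.sum_congr rfl fun s _ => ?_
    have := Finset.prod_univ_sum (fun m => (Finset.univ : Finset (Fin (d m))))
      (fun m i => modeVec hR k r (b r) m i * modeVec hR k s (b' s) m i)
    rw [Fintype.piFinset_univ] at this
    exact this.symm
  rw [h1]
  refine Finset.sum_congr rfl fun r _ => ?_
  have hoff : ∀ s m, m ≠ k → modeVec hR k r (b r) m ⬝ᵥ modeVec hR k s (b' s) m =
      if r = s then 1 else 0 := fun s m hm => by
    simp only [modeVec, Function.update_of_ne hm, single_one_dotProduct, Pi.single_apply]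
    congr 1
    simp [Fin.ext_iff]
  rw [Finset.sum_eq_single r]
  · rw [← Finset.mul_prod_erase _ _ (Finset.mem_univ k), Finset.prod_eq_one]
    · simp [modeVec]
    · intro m hm
      simp [hoff r m (Finset.ne_of_mem_erase hm)]
  · intro s _ hs
    have : Nontrivial (Fin M) := Fin.nontrivial_iff_two_le.mpr hM
    obtain ⟨m, hm⟩ := exists_ne k
    refine Finset.prod_eq_zero (Finset.mem_univ m) ?_
    rw [hoff s m hm, if_neg hs.symm]
  · simp

/-- The rows of the perturbed matrices: every row has the entry `a` in column `j₀` and entries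
`± c` elsewhere. -/
def signRows {n : ℕ} (j₀ : Fin n) (a c : ℝ) (σ : Fin R × {j : Fin n // j ≠ j₀} → Bool)
    (r : Fin R) (j : Fin n) : ℝ :=
  if h : j = j₀ then a else c * sign (σ (r, ⟨j, h⟩))

lemma signRows_dotProduct {n : ℕ} (j₀ : Fin n) (a c c' : ℝ)
    (σ σ' : Fin R × {j : Fin n // j ≠ j₀} → Bool) (r : Fin R) :
    signRows j₀ a c σ r ⬝ᵥ signRows j₀ a c' σ' r =
      a ^ 2 + c * c' * ∑ j, sign (σ (r, j)) * sign (σ' (r, j)) := by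
  rw [dotProduct, Fintype.sum_eq_add_sum_subtype_ne _ j₀, Finset.mul_sum]
  congr 1
  · simp [signRows, sq]
  · refine Finset.sum_congr rfl fun j _ => ?_
    simp only [signRows, j.2, dite_false]
    ring

lemma sum_signRows_dotProduct {n : ℕ} (j₀ : Fin n) (a c c' : ℝ)
    (σ σ' : Fin R × {j : Fin n // j ≠ j₀} → Bool) :
    ∑ r, signRows j₀ a c σ r ⬝ᵥ signRows j₀ a c' σ' r =
      R * a ^ 2 + c * c' * (Fintype.card (Fin R × {j : Fin n // j ≠ j₀}) -
        2 * hammingDist σ σ') := by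
  rw [← sum_sign_mul_sign, Fintype.sum_prod_type, Finset.mul_sum]
  simp [signRows_dotProduct, Finset.sum_add_distrib]

lemma signRows_pos {n : ℕ} (j₀ : Fin n) {a : ℝ} (ha : 0 < a) (c : ℝ)
    (σ : Fin R × {j : Fin n // j ≠ j₀} → Bool) (r : Fin R) :
    0 < signRows j₀ a c σ r ⬝ᵥ signRows j₀ a c σ r := by
  refine Finset.sum_pos' (fun _ _ => mul_self_nonneg _) ⟨j₀, Finset.mem_univ _, ?_⟩
  simp [signRows, ha]

end Embedding

/-! ### Lower bounds from the two families of parameters -/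

section Families

variable {M : ℕ} {d : Fin M → ℕ} {R : ℕ}

lemma isoParam_mean_dist (D D₀ : Tensor d) :
    ((isoParam 0 D).mean₁ - (isoParam 0 D₀).mean₁) ⬝ᵥ
        ((isoParam 0 D).mean₁ - (isoParam 0 D₀).mean₁) =
      (D ⬝ᵥ D - 2 * (D ⬝ᵥ D₀) + D₀ ⬝ᵥ D₀) / 4 ∧
    ((isoParam 0 D).mean₂ - (isoParam 0 D₀).mean₂) ⬝ᵥ
        ((isoParam 0 D).mean₂ - (isoParam 0 D₀).mean₂) =
      (D ⬝ᵥ D - 2 * (D ⬝ᵥ D₀) + D₀ ⬝ᵥ D₀) / 4 := by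
  simp only [isoParam, zero_sub, zero_add, sub_dotProduct, dotProduct_sub, neg_dotProduct,
    dotProduct_neg, smul_dotProduct, dotProduct_smul, smul_eq_mul, dotProduct_comm D₀ D]
  constructor <;> ring

/-- The bound obtained by varying the direction of `D` over a hypercube of dimension
`L = R (d_k - 1)`, at distance `√(ε L / n)` from a fixed direction. -/
lemma le_minimaxProb_directions (hM : 2 ≤ M) {p₁ p₂ : ℝ} (hp₁ : 0 < p₁) (hp₂ : 0 < p₂) {C₀ : ℝ}
    (hC₀ : 1 ≤ C₀) {c₁ Δ ε γ n t : ℝ} (hc₁ : 0 < c₁) (hΔ : c₁ ≤ Δ) (hε : 0 < ε) (hn : 0 < n)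
    (hγ : 0 ≤ γ) (hR : ∀ m, R ≤ d m) (hR1 : 1 ≤ R) {n₁ n₂ : ℕ} (hnε : (n₁ + n₂) * ε ≤ n / 4)
    (k : Fin M) (j₀ : Fin (d k)) {L : ℕ}
    (hL : Fintype.card (Fin R × {j : Fin (d k) // j ≠ j₀}) = L) (hL0 : 0 < L)
    (hδ : 2 * (ε * L / n) ≤ Δ ^ 2) (hLγ : (19 / 20 : ℝ) ^ L ≤ γ ^ 2)
    (ht : 2 * t ≤ directionConst p₁ p₂ c₁ * (Real.exp (-Δ ^ 2 / 8) * (ε * L / n / 4) / Δ)) :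
    ENNReal.ofReal (1 - γ) ≤
      minimaxProb p₁ p₂ n₁ n₂ {θ ∈ paramSpace d R C₀ | θ.snr = Δ} t := by
  classical
  have hΔ0 : 0 < Δ := hc₁.trans_le hΔ
  have hRpos : (0 : ℝ) < R := by exact_mod_cast hR1
  have hLpos : (0 : ℝ) < L := by exact_mod_cast hL0
  set δ2 := ε * L / n with hδ2
  have hδ2pos : 0 < δ2 := by positivity
  have hdiff : 0 < (Δ ^ 2 - δ2) / R := div_pos (by nlinarith) hRpos
  set a := √((Δ ^ 2 - δ2) / R) with ha
  have ha0 : 0 < a := Real.sqrt_pos.mpr hdiff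
  have ha2 : R * a ^ 2 = Δ ^ 2 - δ2 := by
    rw [ha, Real.sq_sqrt hdiff.le, mul_div_cancel₀ _ hRpos.ne']
  set c := √(ε / n) with hc
  have hc2 : c * c = ε / n := Real.mul_self_sqrt (by positivity)
  set D : (Fin R × {j : Fin (d k) // j ≠ j₀} → Bool) → Tensor d :=
    fun σ => cpEmbed hR k (signRows j₀ a c σ) with hD
  set D₀ : Tensor d := cpEmbed hR k (signRows j₀ a 0 fun _ => true) with hD₀
  have hDD : ∀ σ σ', D σ ⬝ᵥ D σ' = Δ ^ 2 - 2 * (ε / n * hammingDist σ σ') := fun σ σ' => by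
    rw [hD, cpEmbed_dotProduct hM, sum_signRows_dotProduct, ha2, hL, hc2, hδ2]
    ring
  have hDself : ∀ σ, D σ ⬝ᵥ D σ = Δ ^ 2 := fun σ => by simp [hDD]
  have hDD₀ : ∀ σ, D σ ⬝ᵥ D₀ = Δ ^ 2 - δ2 := fun σ => by
    rw [hD, hD₀, cpEmbed_dotProduct hM, sum_signRows_dotProduct, ha2]
    ring
  have hD₀D₀ : D₀ ⬝ᵥ D₀ = Δ ^ 2 - δ2 := by
    rw [hD₀, cpEmbed_dotProduct hM, sum_signRows_dotProduct, ha2]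
    ring
  have hdist : ∀ σ, (D σ ⬝ᵥ D σ - 2 * (D σ ⬝ᵥ D₀) + D₀ ⬝ᵥ D₀) / 4 = δ2 / 4 := fun σ => by
    rw [hDself, hDD₀, hD₀D₀]; ring
  refine le_minimaxProb_of_family p₁ p₂ n₁ n₂ (fun _ => 0) D 0 D₀
    (fun σ => isoParam_mem hC₀ hΔ0.le (hDself σ) (hasCPDecomposition_cpEmbed hR k _
      (signRows_pos j₀ ha0 c σ))) (v := δ2 / 4) (q := (337 / 384) ^ L)
    (fun σ => ((isoParam_mean_dist _ _).1.trans (hdist σ)).le)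
    (fun σ => ((isoParam_mean_dist _ _).2.trans (hdist σ)).le) ?_ hγ (by positivity) ?_
  · intro Υ hΥ
    have hcard : (337 / 384 : ℝ) ^ L *
        Fintype.card (Fin R × {j : Fin (d k) // j ≠ j₀} → Bool) = (337 / 192) ^ L := by
      rw [Fintype.card_fun, hL, Fintype.card_bool, Nat.cast_pow, ← mul_pow]
      norm_num
    rw [hcard]
    rcases (Finset.univ.filter fun σ =>
      excessRisk p₁ p₂ (isoParam 0 (D σ)) Υ < t).eq_empty_or_nonempty with he | ⟨σ₀, hσ₀⟩
    · rw [he]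
      simp only [Finset.card_empty, Nat.cast_zero]
      positivity
    -- all parameters for which the rule is good lie in one Hamming ball
    · refine le_trans ?_ ((card_hammingBall_le σ₀).trans_eq (by rw [hL]))
      refine Nat.cast_le.mpr (Finset.card_le_card fun σ hσ => ?_)
      rw [Finset.mem_filter] at hσ hσ₀ ⊢
      refine ⟨Finset.mem_univ _, not_lt.mp fun hlt => ?_⟩
      rw [hL] at hlt
      have hH1 : (L : ℝ) ≤ 4 * hammingDist σ σ₀ := by exact_mod_cast hlt.le
      have hH2 : (hammingDist σ σ₀ : ℝ) ≤ L := by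
        rw [← hL]; exact_mod_cast hammingDist_le_card_fintype
      have hη0 : 0 < ε / n * hammingDist σ σ₀ := mul_pos (by positivity) (by linarith)
      have hη2 : √(ε / n * hammingDist σ σ₀) ^ 2 = ε / n * hammingDist σ σ₀ := Real.sq_sqrt hη0.le
      have hup : ε / n * hammingDist σ σ₀ ≤ δ2 := by
        rw [hδ2, mul_div_right_comm]; gcongr
      have hlow : δ2 / 4 ≤ ε / n * hammingDist σ σ₀ := by
        have : ε / n * L ≤ ε / n * (4 * hammingDist σ σ₀) := by gcongr
        rw [hδ2, mul_div_right_comm]; linarith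
      have hsep := excessRisk_add_ge_directions hp₁ hp₂ hc₁ hΔ (Real.sqrt_pos.mpr hη0)
        (by rw [hη2]; linarith) (hDself σ) (hDself σ₀) (by rw [hη2, hDD]) hΥ
      rw [hη2] at hsep
      have hmono : directionConst p₁ p₂ c₁ * (Real.exp (-Δ ^ 2 / 8) * (δ2 / 4) / Δ) ≤
          directionConst p₁ p₂ c₁ *
            (Real.exp (-Δ ^ 2 / 8) * (ε / n * hammingDist σ σ₀) / Δ) := by
        have := directionConst_pos hp₁ hp₂ c₁
        gcongr
      linarith [hσ.2, hσ₀.2]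
  -- the perturbation is small enough for `exp (1 / 16) ≤ 16 / 15` per coordinate of the hypercube to
  -- leave most of the gain `337 / 384` per coordinate from the Hamming balls
  · have hexp : Real.exp ((n₁ + n₂) * (δ2 / 4)) ≤ (16 / 15) ^ L := by
      have h1 : (n₁ + n₂) * (δ2 / 4) ≤ L * (1 / 16) := by
        have : (n₁ + n₂) * (δ2 / 4) = (n₁ + n₂) * ε / n * (L / 4) := by rw [hδ2]; ring
        rw [this]
        have h2 : (n₁ + n₂) * ε / n ≤ 1 / 4 := by
          rw [div_le_iff₀ hn]; linarith
        calc (n₁ + n₂) * ε / n * (L / 4) ≤ 1 / 4 * (L / 4) := by gcongr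
          _ = L * (1 / 16) := by ring
      calc Real.exp ((n₁ + n₂) * (δ2 / 4)) ≤ Real.exp (L * (1 / 16)) := Real.exp_le_exp.mpr h1
        _ = Real.exp (1 / 16) ^ L := Real.exp_nat_mul _ _
        _ ≤ (16 / 15) ^ L := by
          gcongr
          have h3 := Real.one_sub_le_exp_neg (1 / 16)
          rw [Real.exp_neg] at h3
          have h4 := (le_inv_comm₀ (by norm_num) (Real.exp_pos _)).mp h3
          norm_num at h4 ⊢
          exact h4
    calc Real.exp ((n₁ + n₂) * (δ2 / 4)) * (337 / 384) ^ L
        ≤ (16 / 15) ^ L * (337 / 384) ^ L := by gcongr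
      _ = (16 / 15 * (337 / 384)) ^ L := (mul_pow _ _ _).symm
      _ ≤ (19 / 20) ^ L := by gcongr; norm_num
      _ ≤ γ ^ 2 := hLγ

/-- The bound obtained by moving the midpoint of the two means along `D`, by `N` equal steps of
total length at most `1 / (2 √(n₁ + n₂))`. -/
lemma le_minimaxProb_locations {p₁ p₂ : ℝ} (hp₁ : 0 < p₁) (hp₂ : 0 < p₂) {C₀ : ℝ}
    (hC₀ : 1 ≤ C₀) {c₁ Δ γ t : ℝ} (hc₁ : 0 < c₁) (hΔ : c₁ ≤ Δ) (hγ : 0 ≤ γ) {n₁ n₂ : ℕ}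
    (hn₁ : 1 ≤ n₁) {D : Tensor d} (hD : D ⬝ᵥ D = Δ ^ 2) (hcp : HasCPDecomposition R D) {N : ℕ}
    (hN : 0 < N) (hNγ : 2 / N ≤ γ ^ 2)
    (ht : 2 * t ≤ locationConst p₁ p₂ c₁ *
      (Real.exp (-Δ ^ 2 / 8) * Δ * (1 / (4 * N ^ 2 * (n₁ + n₂))))) :
    ENNReal.ofReal (1 - γ) ≤
      minimaxProb p₁ p₂ n₁ n₂ {θ ∈ paramSpace d R C₀ | θ.snr = Δ} t := by
  classical
  have hΔ0 : 0 < Δ := hc₁.trans_le hΔ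
  have hN0 : (0 : ℝ) < N := by exact_mod_cast hN
  have hs1 : (1 : ℝ) ≤ n₁ + n₂ := by exact_mod_cast hn₁.trans (Nat.le_add_right _ _)
  have hs0 : (0 : ℝ) < n₁ + n₂ := by linarith
  set τ : ℝ := 1 / (2 * N * √(n₁ + n₂)) with hτ
  have hsq : √((n₁ : ℝ) + n₂) ^ 2 = n₁ + n₂ := Real.sq_sqrt hs0.le
  have hsqrt : 1 ≤ √((n₁ : ℝ) + n₂) := Real.one_le_sqrt.mpr hs1
  have hτ0 : 0 < τ := by positivity
  have hτ2 : τ ^ 2 = 1 / (4 * N ^ 2 * (n₁ + n₂)) := by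
    rw [hτ, div_pow, mul_pow, mul_pow, hsq]; norm_num
  have hNτ2 : (N * τ) ^ 2 = 1 / (4 * (n₁ + n₂)) := by
    rw [mul_pow, hτ2]; field_simp
  have hNτ1 : N * τ ≤ 1 := by
    have : (N * τ) ^ 2 ≤ 1 ^ 2 := by
      rw [hNτ2, one_pow, div_le_one (by positivity)]; linarith
    exact (abs_le_of_sq_le_sq' this zero_le_one).2
  have hle : ∀ i : Fin N, (i : ℝ) * τ ≤ N * τ := fun i => by
    gcongr
    exact_mod_cast i.2.le
  have : Nonempty (Fin N) := ⟨⟨0, hN⟩⟩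
  have hdist : ∀ i : Fin N, (((i : ℝ) * τ / Δ) • D) ⬝ᵥ (((i : ℝ) * τ / Δ) • D) ≤
      1 / (4 * (n₁ + n₂)) := fun i => by
    rw [smul_dotProduct, dotProduct_smul, hD, smul_eq_mul, smul_eq_mul, ← hNτ2]
    have : (i : ℝ) * τ / Δ * ((i : ℝ) * τ / Δ * Δ ^ 2) = ((i : ℝ) * τ) ^ 2 := by
      field_simp
    rw [this]
    have := hle i
    gcongr
  refine le_minimaxProb_of_family p₁ p₂ n₁ n₂ (fun i : Fin N => ((i : ℝ) * τ / Δ) • D)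
    (fun _ => D) 0 D (fun i => isoParam_mem hC₀ hΔ0.le hD hcp) (v := 1 / (4 * (n₁ + n₂)))
    (q := 1 / N) (fun i => ?_) (fun i => ?_) ?_ hγ (by positivity) ?_
  · convert hdist i using 2 <;> simp [isoParam]
  · convert hdist i using 2 <;> simp [isoParam]
  · intro Υ hΥ
    rw [Fintype.card_fin, one_div_mul_cancel hN0.ne']
    have hlt : ∀ i j : Fin N, i < j →
        excessRisk p₁ p₂ (isoParam (((i : ℝ) * τ / Δ) • D) D) Υ < t →
        excessRisk p₁ p₂ (isoParam (((j : ℝ) * τ / Δ) • D) D) Υ < t → False := by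
      intro i j hij hi hj
      have hij' : (i : ℝ) + 1 ≤ j := by exact_mod_cast hij
      have hgap : τ ≤ j * τ - i * τ := by nlinarith
      have hsep := excessRisk_add_ge_locations hp₁ hp₂ hc₁ hΔ (t := i * τ) (t' := j * τ)
        (by positivity) (by linarith) ((hle j).trans hNτ1) hD hΥ
      have hmono : locationConst p₁ p₂ c₁ * (Real.exp (-Δ ^ 2 / 8) * Δ * τ ^ 2) ≤
          locationConst p₁ p₂ c₁ * (Real.exp (-Δ ^ 2 / 8) * Δ * (j * τ - i * τ) ^ 2) := by
        have := locationConst_pos hp₁ hp₂ c₁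
        gcongr
      rw [hτ2] at hmono
      linarith
    norm_cast
    refine Finset.card_le_one.mpr fun i hi j hj => ?_
    rw [Finset.mem_filter] at hi hj
    rcases lt_trichotomy i j with h | h | h
    · exact (hlt i j h hi.2 hj.2).elim
    · exact h
    · exact (hlt j i h hj.2 hi.2).elim
  · have h1 : ((n₁ : ℝ) + n₂) * (1 / (4 * (n₁ + n₂))) = 1 / 4 := by field_simp
    rw [h1]
    have h2 : Real.exp (1 / 4) ≤ 2 := by
      have h3 := Real.one_sub_le_exp_neg (1 / 4)
      rw [Real.exp_neg] at h3
      have h4 := (le_inv_comm₀ (by norm_num) (Real.exp_pos _)).mp h3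
      norm_num at h4 ⊢
      linarith
    calc Real.exp (1 / 4) * (1 / N) ≤ 2 * (1 / N) := by gcongr
      _ = 2 / N := by ring
      _ ≤ γ ^ 2 := hNγ

end Families

/-! ### The minimax lower bound -/

/-- The non-asymptotic lower bound behind both regimes of the signal-to-noise ratio. The factor
`exp (-Δ ^ 2 / 8) / Δ` is of constant order for bounded `Δ`, and equals
`exp (-(1 / 8 + log Δ / Δ ^ 2) Δ ^ 2)` in general. -/
theorem exists_le_minimaxProb {M : ℕ} (hM : 2 ≤ M) {p₁ p₂ : ℝ} (hp₁ : 0 < p₁) (hp₂ : 0 < p₂)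
    {C₀ : ℝ} (hC₀ : 1 ≤ C₀) (κ : ℝ) {c₁ K γ : ℝ} (hc₁ : 0 < c₁) (hK : 0 < K) (hγ : 0 < γ) :
    ∃ C : ℝ, 0 < C ∧ ∀ (d : Fin M → ℕ) (R n₁ n₂ : ℕ) (Δ : ℝ),
      1 ≤ R → (∀ m, R ≤ d m) → 1 ≤ n₁ → 1 ≤ n₂ → (n₁ : ℝ) ≤ κ * n₂ → (n₂ : ℝ) ≤ κ * n₁ →
      rate d R (min n₁ n₂) ≤ K * Δ ^ 2 → c₁ ≤ Δ →
      ENNReal.ofReal (1 - γ) ≤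
        minimaxProb p₁ p₂ n₁ n₂ {θ ∈ paramSpace d R C₀ | θ.snr = Δ}
          (C * (Real.exp (-Δ ^ 2 / 8) / Δ) * rate d R (min n₁ n₂)) := by
  -- hypercubes of dimension greater than `L₀` use directions, the others `N` locations
  obtain ⟨L₀, hL₀⟩ := exists_pow_lt_of_lt_one (pow_pos hγ 2) (by norm_num : (19 / 20 : ℝ) < 1)
  obtain ⟨N, hN⟩ := exists_nat_gt (2 / γ ^ 2)
  have hN0 : (0 : ℝ) < N := lt_of_le_of_lt (by positivity) hN
  have hNγ : 2 / (N : ℝ) ≤ γ ^ 2 := by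
    rw [div_lt_iff₀ (by positivity)] at hN
    rw [div_le_iff₀ hN0]
    linarith
  have hM0 : (0 : ℝ) < M := by
    have : 0 < M := by omega
    exact_mod_cast this
  set ε : ℝ := min (1 / (4 * (1 + |κ|))) (1 / (2 * K)) with hε
  have hε0 : 0 < ε := by positivity
  have hdc := directionConst_pos hp₁ hp₂ c₁
  have hlc := locationConst_pos hp₁ hp₂ c₁
  set C₁ := directionConst p₁ p₂ c₁ * ε / (16 * M) with hC₁
  set C₂ := locationConst p₁ p₂ c₁ * c₁ ^ 2 / (16 * M * (L₀ + 1) * N ^ 2 * (1 + |κ|)) with hC₂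
  refine ⟨min C₁ C₂, by positivity, ?_⟩
  intro d R n₁ n₂ Δ hR1 hR hn₁ hn₂ hκ₁ hκ₂ hrate hΔ
  have hΔ0 : 0 < Δ := hc₁.trans_le hΔ
  set n : ℝ := ((min n₁ n₂ : ℕ) : ℝ) with hn
  have hn1 : 1 ≤ n := by rw [hn]; exact_mod_cast le_min hn₁ hn₂
  have hn0 : 0 < n := by linarith
  have hsum : (n₁ + n₂ : ℝ) ≤ (1 + |κ|) * n := by
    have hk : ∀ x : ℝ, 0 ≤ x → κ * x ≤ |κ| * x := fun x hx => by gcongr; exact le_abs_self κ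
    rcases le_total n₁ n₂ with h | h
    · rw [hn, min_eq_left h]
      linarith [hk n₁ (Nat.cast_nonneg _)]
    · rw [hn, min_eq_right h]
      linarith [hk n₂ (Nat.cast_nonneg _)]
  -- only the largest mode is perturbed: it carries a fraction `1 / M` of the parameters
  have : Nonempty (Fin M) := ⟨⟨0, by omega⟩⟩
  obtain ⟨k, hk⟩ := Finite.exists_max d
  have hdk : 1 ≤ d k := hR1.trans (hR k)
  have hsumd : ∑ m, (d m : ℝ) ≤ M * d k := by
    calc ∑ m, (d m : ℝ) ≤ ∑ _m : Fin M, (d k : ℝ) :=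
          Finset.sum_le_sum fun m _ => by exact_mod_cast hk m
      _ = M * d k := by simp
  have hdsum : (d k : ℝ) ≤ ∑ m, (d m : ℝ) :=
    Finset.single_le_sum (f := fun m => (d m : ℝ)) (fun _ _ => Nat.cast_nonneg _)
      (Finset.mem_univ k)
  have hratele : rate d R (min n₁ n₂) ≤ M * (R * d k : ℕ) / n := by
    rw [rate, ← hn]
    refine div_le_div_of_nonneg_right ?_ hn0.le
    push_cast
    calc (∑ m, (d m : ℝ)) * R ≤ M * d k * R := by gcongr
      _ = M * (R * d k) := by ring
  have hrate0 : 0 ≤ rate d R (min n₁ n₂) := by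
    unfold rate; positivity
  have hexp0 : 0 < Real.exp (-Δ ^ 2 / 8) / Δ := by positivity
  let j₀ : Fin (d k) := ⟨0, hdk⟩
  set L : ℕ := Fintype.card (Fin R × {j : Fin (d k) // j ≠ j₀}) with hL
  have hLval : L = R * (d k - 1) := by
    rw [hL, Fintype.card_prod, Fintype.card_fin, Fintype.card_subtype_compl]
    simp
  have hRd : R * d k = L + R := by
    rw [hLval]
    obtain ⟨e, he⟩ := Nat.exists_eq_add_of_le' hdk
    rw [he]
    simp [mul_add]
  rcases le_or_gt (L₀ + 1) L with hcase | hcase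
  · have hL0 : 0 < L := by omega
    have hRL : R ≤ L := by
      rw [hLval] at hL0 ⊢
      exact Nat.le_mul_of_pos_right _ (Nat.pos_of_mul_pos_left hL0)
    have hLrate : (L : ℝ) / n ≤ rate d R (min n₁ n₂) := by
      rw [rate, ← hn]
      gcongr
      have h1 : (L : ℝ) ≤ R * d k := by
        have : L ≤ R * d k := by omega
        exact_mod_cast this
      calc (L : ℝ) ≤ d k * R := by linarith
        _ ≤ (∑ m, (d m : ℝ)) * R := by gcongr
    refine le_minimaxProb_directions hM hp₁ hp₂ hC₀ hc₁ hΔ hε0 hn0 hγ.le hR hR1 ?_ k j₀ hL.symm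
      hL0 ?_ ((pow_le_pow_of_le_one (by norm_num) (by norm_num) (by omega)).trans hL₀.le) ?_
    · have h1 : ε ≤ 1 / (4 * (1 + |κ|)) := min_le_left _ _
      calc (n₁ + n₂) * ε ≤ (1 + |κ|) * n * (1 / (4 * (1 + |κ|))) := by gcongr
        _ = n / 4 := by field_simp
    · have h1 : ε ≤ 1 / (2 * K) := min_le_right _ _
      calc 2 * (ε * L / n) = 2 * (ε * (L / n)) := by ring
        _ ≤ 2 * (1 / (2 * K) * (K * Δ ^ 2)) := by
          have := hLrate.trans hrate
          gcongr
        _ = Δ ^ 2 := by field_simp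
    · have h2 : rate d R (min n₁ n₂) ≤ M * (2 * L) / n := by
        refine hratele.trans ?_
        have : R * d k ≤ 2 * L := by omega
        have : ((R * d k : ℕ) : ℝ) ≤ 2 * L := by exact_mod_cast this
        gcongr
      calc 2 * (min C₁ C₂ * (Real.exp (-Δ ^ 2 / 8) / Δ) * rate d R (min n₁ n₂))
          ≤ 2 * (C₁ * (Real.exp (-Δ ^ 2 / 8) / Δ) * (M * (2 * L) / n)) := by
            gcongr
            exact min_le_left _ _
        _ = directionConst p₁ p₂ c₁ * (Real.exp (-Δ ^ 2 / 8) * (ε * L / n / 4) / Δ) := by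
            rw [hC₁]; field_simp; norm_num
  · -- a matrix with all its mass in one column
    set b : Fin R → Fin (d k) → ℝ := signRows j₀ (√(Δ ^ 2 / R)) 0 fun _ => true with hb
    have hR0 : (0 : ℝ) < R := by exact_mod_cast hR1
    have hD : cpEmbed hR k b ⬝ᵥ cpEmbed hR k b = Δ ^ 2 := by
      rw [cpEmbed_dotProduct hM, hb, sum_signRows_dotProduct, Real.sq_sqrt (by positivity)]
      field_simp
      ring
    refine le_minimaxProb_locations hp₁ hp₂ hC₀ hc₁ hΔ hγ.le hn₁ hD
      (hasCPDecomposition_cpEmbed hR k b fun r =>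
        signRows_pos j₀ (Real.sqrt_pos.mpr (by positivity)) 0 _ r) (by exact_mod_cast hN0) hNγ ?_
    have h2 : rate d R (min n₁ n₂) ≤ M * (2 * (L₀ + 1)) / n := by
      refine hratele.trans ?_
      have : R * d k ≤ 2 * (L₀ + 1) := by
        rcases Nat.lt_or_ge 1 (d k) with h | h
        · have : R ≤ L := by
            rw [hLval]
            exact Nat.le_mul_of_pos_right _ (by omega)
          omega
        · have hd1 : d k = 1 := by omega
          have := hR k
          rw [hd1] at this ⊢
          omega
      have : ((R * d k : ℕ) : ℝ) ≤ 2 * (L₀ + 1) := by exact_mod_cast this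
      gcongr
    have h3 : c₁ ^ 2 / Δ ≤ Δ := by
      rw [div_le_iff₀ hΔ0, ← sq]; gcongr
    have h4 : 0 < (n₁ : ℝ) + n₂ := by
      have : (1 : ℝ) ≤ n₁ := by exact_mod_cast hn₁
      positivity
    calc 2 * (min C₁ C₂ * (Real.exp (-Δ ^ 2 / 8) / Δ) * rate d R (min n₁ n₂))
        ≤ 2 * (C₂ * (Real.exp (-Δ ^ 2 / 8) / Δ) * (M * (2 * (L₀ + 1)) / n)) := by
          gcongr
          exact min_le_right _ _
      _ = locationConst p₁ p₂ c₁ *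
          (Real.exp (-Δ ^ 2 / 8) * (c₁ ^ 2 / Δ) * (1 / (4 * N ^ 2 * ((1 + |κ|) * n)))) := by
          rw [hC₂]; field_simp; norm_num
      _ ≤ _ := by gcongr

end TGMM

theorem theorem3p4
    {M : ℕ} (hM : 2 ≤ M) (p₁ p₂ : ℝ) (hp₁ : 0 < p₁) (hp₂ : 0 < p₂) (hp : p₁ + p₂ = 1)
    (C₀ : ℝ) (hC₀ : 1 ≤ C₀) (κ : ℝ) :
    -- (i) bounded signal-to-noise ratio
    (∀ c₁ c₂ K γ : ℝ, 0 < c₁ → c₁ < c₂ → 0 < γ →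
      ∃ C : ℝ, 0 < C ∧
        ∀ (d : Fin M → ℕ) (R n₁ n₂ : ℕ) (Δ : ℝ),
          1 ≤ R → (∀ m, R ≤ d m) → 1 ≤ n₁ → 1 ≤ n₂ →
          (n₁ : ℝ) ≤ κ * n₂ → (n₂ : ℝ) ≤ κ * n₁ →
          TGMM.rate d R (min n₁ n₂) ≤ K →
          c₁ < Δ → Δ ≤ c₂ →
          ENNReal.ofReal (1 - γ) ≤
            TGMM.minimaxProb p₁ p₂ n₁ n₂ {θ ∈ TGMM.paramSpace d R C₀ | θ.snr = Δ}
              (C * TGMM.rate d R (min n₁ n₂))) ∧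
    -- (ii) diverging signal-to-noise ratio
    (∀ γ : ℝ, 0 < γ →
      ∃ C : ℝ, 0 < C ∧
        ∀ (d : ℕ → Fin M → ℕ) (R n₁ n₂ : ℕ → ℕ) (Δ : ℕ → ℝ),
          (∀ n, 1 ≤ R n) → (∀ n m, R n ≤ d n m) →
          (∀ n, min (n₁ n) (n₂ n) = n) →
          (∀ n, (n₁ n : ℝ) ≤ κ * n₂ n) → (∀ n, (n₂ n : ℝ) ≤ κ * n₁ n) →
          Tendsto Δ atTop atTop →
          (fun n => √(TGMM.rate (d n) (R n) n)) =o[atTop] Δ →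
          ∃ ϑ : ℕ → ℝ, Tendsto ϑ atTop (𝓝 0) ∧
            ∀ᶠ n in atTop,
              ENNReal.ofReal (1 - γ) ≤
                TGMM.minimaxProb p₁ p₂ (n₁ n) (n₂ n)
                  {θ ∈ TGMM.paramSpace (d n) (R n) C₀ | θ.snr = Δ n}
                  (C * Real.exp (-(1 / 8 + ϑ n) * Δ n ^ 2) * TGMM.rate (d n) (R n) n)) := by
  constructor
  · intro c₁ c₂ K γ hc₁ hc₁₂ hγ
    obtain ⟨C, hC, h⟩ := TGMM.exists_le_minimaxProb hM hp₁ hp₂ hC₀ κ hc₁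
      (K := (|K| + 1) / c₁ ^ 2) (by positivity) hγ
    have hc₂ : 0 < c₂ := hc₁.trans hc₁₂
    refine ⟨C * (Real.exp (-c₂ ^ 2 / 8) / c₂), by positivity, ?_⟩
    intro d R n₁ n₂ Δ hR1 hR hn₁ hn₂ hκ₁ hκ₂ hrate hΔ₁ hΔ₂
    have hΔ0 : 0 < Δ := hc₁.trans hΔ₁
    have hrate0 : 0 ≤ TGMM.rate d R (min n₁ n₂) := by
      unfold TGMM.rate; positivity
    refine (h d R n₁ n₂ Δ hR1 hR hn₁ hn₂ hκ₁ hκ₂ (hrate.trans ?_) hΔ₁.le).trans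
      (TGMM.minimaxProb_antitone _ _ _ _ _ ?_)
    · calc K ≤ |K| + 1 := by linarith [le_abs_self K]
        _ = (|K| + 1) / c₁ ^ 2 * c₁ ^ 2 := by field_simp
        _ ≤ (|K| + 1) / c₁ ^ 2 * Δ ^ 2 := by gcongr
    · gcongr
  · intro γ hγ
    obtain ⟨C, hC, h⟩ := TGMM.exists_le_minimaxProb hM hp₁ hp₂ hC₀ κ one_pos one_pos hγ
    refine ⟨C, hC, ?_⟩
    intro d R n₁ n₂ Δ hR1 hR hmin hκ₁ hκ₂ hΔ hrate
    refine ⟨fun n => Real.log (Δ n) / Δ n ^ 2, ?_, ?_⟩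
    · have hlog := (isLittleO_log_rpow_atTop two_pos).tendsto_div_nhds_zero.comp hΔ
      simpa [Function.comp_def] using hlog
    · filter_upwards [hΔ.eventually_ge_atTop 1, hrate.bound one_pos, eventually_ge_atTop 1]
        with n hΔ1 hb hn1
      have hΔ0 : 0 < Δ n := by linarith
      have hn := hmin n
      have hrate0 : 0 ≤ TGMM.rate (d n) (R n) n := by
        unfold TGMM.rate; positivity
      have hrate1 : TGMM.rate (d n) (R n) n ≤ 1 * Δ n ^ 2 := by
        rw [Real.norm_of_nonneg (Real.sqrt_nonneg _), Real.norm_of_nonneg hΔ0.le, one_mul,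
          Real.sqrt_le_left hΔ0.le] at hb
        linarith
      have hfin := h (d n) (R n) (n₁ n) (n₂ n) (Δ n) (hR1 n) (hR n) (by omega) (by omega) (hκ₁ n)
        (hκ₂ n) (by rwa [hn]) hΔ1
      rw [hn] at hfin
      have hexp : Real.exp (-(1 / 8 + Real.log (Δ n) / Δ n ^ 2) * Δ n ^ 2) =
          Real.exp (-Δ n ^ 2 / 8) / Δ n := by
        have : -(1 / 8 + Real.log (Δ n) / Δ n ^ 2) * Δ n ^ 2 =
            -Δ n ^ 2 / 8 - Real.log (Δ n) := by
          field_simp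
          ring
        rw [this, Real.exp_sub, Real.exp_log hΔ0]
      rwa [hexp]
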